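/- **Setting.** Let $d,k,m,T\ge 1$. A defender plays $T$ repeated Stackelberg games (tasks), each with $m$ rounds, over $d$ targets and against $k$ attacker types. In each round the defender commits to a coverage vector $x\in\Delta^d$ (the probability simplex). An attacker of type $j$ then attacks the target $b_j(x)$ that maximizes his expected utility $\langle x, p_j(a)\rangle$ over $a\in[d]$, where the $p_j(a)\in\mathbb R^d$ are fixed payoff vectors and ties are broken by a fixed priority order. (Security games are the case where $p_j(a)$ has one entry at $a$ (covered) and a common entry elsewhere (uncovered).) The defender in task $t$ receives $\langle x,u^{(t)}(b_j(x))\rangle$, where $u^{(t)}(a)\in[-1,1]^d$. The sequence of attacker types $f_{t,i}\in[k]$ is arbitrary, chosen independently of the realized random plays, and $f_{t,i}$ is revealed after round $i$. The Stackelberg regret of task $t$ for plays $x^{(t,1)},\dots,x^{(t,m)}$ is $$\mathrm{SReg}^{(t,m)}=\sup_{x\in\Delta^d}\sum_{i=1}^m\langle x,u^{(t)}(b_{f_{t,i}}(x))\rangle-\sum_{i=1}^m\langle x^{(t,i)},u^{(t)}(b_{f_{t,i}}(x^{(t,i)}))\rangle .$$ **Extreme points.** Put $\alpha=1/\sqrt{mT}$.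 For $\sigma:[k]\to[d]$ let $P_\sigma=\{x\in\Delta^d: b_j(x)=\sigma(j)\ \forall j\}$. A set $\mathcal E$ of $\alpha$-approximate extreme points (Balcan, Blum, Haghtalab, Procaccia 2015) consists of exactly the following points: for each $\sigma$ and each extreme point $e$ of the closure of $P_\sigma$, the point $e$ if $e\in P_\sigma$, and otherwise one chosen point $p\in P_\sigma$ with $\|p-e\|_1\le\alpha$. **Algorithm.** Let $v^{(t,i)}(x)=\langle x,u^{(t)}(b_{f_{t,i}}(x))\rangle$ for $x\in\mathcal E$. Let $\mathring y^{(t)}$ be any optimum-in-hindsight distribution on $\mathcal E$ for task $t$, that is, a maximizer of $\sum_i\langle y,v^{(t,i)}\rangle$ over distributions $y$ on $\mathcal E$. Let $\tilde y^{(t)}=(1-\alpha)\mathring y^{(t)}+\frac{\alpha}{|\mathcal E|}\mathbf 1$ and $\bar y=\frac1T\sum_{t=1}^T\mathring y^{(t)}$. In task $t$ the defender runs multiplicative weights on $\mathcal E$: the play $x^{(t,i)}$ is drawn from $y^{(t,i)}$, where $y^{(t,1)}=y^{(t,0)}$ is the initialization and $y^{(t,i+1)}(x)\propto y^{(t,i)}(x)\exp(\eta_t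 v^{(t,i)}(x))$. The initialization $y^{(t,0)}$ is uniform for $t=1$, and is $\frac1{t-1}\sum_{s<t}\tilde y^{(s)}$ for $t\ge2$. The learning rate is given by exponentially weighted online optimization (EWOO), $$\eta_t=\frac{\int_{\rho D}^{\sqrt{D^2+\rho^2D^2}}\eta\, e^{-\beta\sum_{s<t}U_s(\eta)}\,d\eta}{\int_{\rho D}^{\sqrt{D^2+\rho^2D^2}}e^{-\beta\sum_{s<t}U_s(\eta)}\,d\eta},\qquad U_s(\eta)=m\Big(\eta+\frac{D_{\mathrm{KL}}(\tilde y^{(s)}\|y^{(s,0)})/m+\rho^2D^2}{\eta}\Big),$$ with $D=\sqrt{\log(|\mathcal E|/\alpha)/m}$, $\rho=T^{-1/4}$, $\beta=\frac{2}{mD}\min\{1,\rho^2\}$. (If $D=0$, which happens only for $|\mathcal E|=m=T=1$, the value of $\eta_t$ is irrelevant and is set to $0$.) **Theorem.** A set $\mathcal E$ as above exists, and every such set is finite and nonempty. For every such $\mathcal E$, all defender utilities, all attacker sequences and all choices of the optima $\mathring y^{(t)}$, each $\mathrm{SReg}^{(t,m)}$ is integrable, and the following holds, where the expectation is over the randomness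 of the plays and $H(\bar y)=-\sum_{x\in\mathcal E}\bar y(x)\log\bar y(x)$. For every $\eta>0$, $$\frac1T\sum_{t=1}^T\mathbb E[\mathrm{SReg}^{(t,m)}]\le4\sqrt{\frac mT}+\sqrt{m\log(|\mathcal E|\sqrt{mT})}\left(\min\left\{\frac{\sqrt{\log(|\mathcal E|\sqrt{mT})}}{\eta\sqrt{Tm}},\frac1{T^{1/4}}\right\}+\frac{1+\log(T+1)}{2\sqrt T}\right)+\eta m+\frac{H(\bar y)}{\eta}+\frac{8|\mathcal E|\sqrt m(\log T+1)}{\eta\sqrt T}.$$ In particular, for every $\bar\eta>0$ this holds with $\eta=\eta^*$ the minimizer over $0<\eta\le\bar\eta$ of the sum of the last three terms. Consequently the task-averaged expected regret is $O(\sqrt{H(\bar y)m})$ plus terms vanishing in $T$; explicitly, $$\frac1T\sum_{t=1}^T\mathbb E[\mathrm{SReg}^{(t,m)}]\le2\sqrt{H(\bar y)\,m}+\frac{16\,m\,|\mathcal E|\,(1+\log T)}{T^{1/4}} .$$ -/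

import Mathlib

open Real Finset MeasureTheory

/-- An attacker type. If the defender commits to the coverage vector `x` and target `a` is attacked,
the expected utility of the attacker is `⟨x, payoff a⟩`. The classical security-game payoff
`c a * x a + w a * (1 - x a)` (covered / uncovered) is the case where the vector `payoff a` has the
entry `c a` at `a` and the entry `w a` elsewhere, since the coordinates of `x` sum to one.
Ties are broken by a fixed priority order (the smallest `priority` wins). -/
structure AttackerType (d : ℕ) where
  payoff : Fin d → Fin d → ℝ
  priority : Equiv.Perm (Fin d)

/-- Target `a` is the best response to `x`: it maximizes the expected utility of the attacker and has
the best priority among the maximizers. -/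
def IsBestResponse {d : ℕ} (θ : AttackerType d) (x : Fin d → ℝ) (a : Fin d) : Prop :=
  (∀ b, x ⬝ᵥ θ.payoff b ≤ x ⬝ᵥ θ.payoff a) ∧
    ∀ b, x ⬝ᵥ θ.payoff b = x ⬝ᵥ θ.payoff a → θ.priority a ≤ θ.priority b

theorem exists_isBestResponse {d : ℕ} [NeZero d] (θ : AttackerType d) (x : Fin d → ℝ) :
    ∃ a, IsBestResponse θ x a := by
  obtain ⟨a₀, -, h₀⟩ := Finset.exists_max_image Finset.univ (fun b => x ⬝ᵥ θ.payoff b)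
    ⟨(0 : Fin d), Finset.mem_univ _⟩
  obtain ⟨a, ha, hmin⟩ := Finset.exists_min_image
    (Finset.univ.filter fun b => x ⬝ᵥ θ.payoff b = x ⬝ᵥ θ.payoff a₀) θ.priority
    ⟨a₀, by simp⟩
  have haa : x ⬝ᵥ θ.payoff a = x ⬝ᵥ θ.payoff a₀ := (Finset.mem_filter.1 ha).2
  refine ⟨a, fun b => haa ▸ h₀ b (Finset.mem_univ b), fun b hb => hmin b ?_⟩
  exact Finset.mem_filter.2 ⟨Finset.mem_univ b, hb.trans haa⟩

/-- The target attacked by an attacker of type `θ` when the defender commits to `x`. -/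
noncomputable def bestResponse {d : ℕ} [NeZero d] (θ : AttackerType d) (x : Fin d → ℝ) : Fin d :=
  Classical.choose (exists_isBestResponse θ x)

/-- The coverage vectors to which every attacker type `j` responds with the target `σ j`. -/
def responseRegion {d k : ℕ} [NeZero d] (θ : Fin k → AttackerType d) (σ : Fin k → Fin d) :
    Set (Fin d → ℝ) :=
  {x | x ∈ stdSimplex ℝ (Fin d) ∧ ∀ j, bestResponse (θ j) x = σ j}

/-- `E` is a set of `γ`-approximate extreme points (Balcan, Blum, Haghtalab, Procaccia): for each
assignment `σ` and each extreme point `e` of the closure of its response region, `E` has the point `e`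
itself if `e` lies in the region, and otherwise one chosen point of the region at `ℓ¹`-distance at most
`γ` from `e`; and `E` has no further points. -/
def IsExtremePointSet {d k : ℕ} [NeZero d] (θ : Fin k → AttackerType d) (γ : ℝ)
    (E : Set (Fin d → ℝ)) : Prop :=
  ∃ rep : (Fin k → Fin d) → (Fin d → ℝ) → (Fin d → ℝ),
    (∀ σ, ∀ e ∈ (closure (responseRegion θ σ)).extremePoints ℝ,
      rep σ e ∈ responseRegion θ σ ∧ ∑ i, |rep σ e i - e i| ≤ γ ∧
        (e ∈ responseRegion θ σ → rep σ e = e)) ∧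
    E = {p | ∃ σ, ∃ e ∈ (closure (responseRegion θ σ)).extremePoints ℝ, rep σ e = p}

/-- The utility `⟨x, u (b x)⟩` of the defender for committing to `x` against an attacker of type `θ`
with best response `b`; `u a` is the payoff vector of the defender when target `a` is attacked. -/
noncomputable def defenderUtility {d : ℕ} [NeZero d] (θ : AttackerType d) (u : Fin d → Fin d → ℝ)
    (x : Fin d → ℝ) : ℝ :=
  x ⬝ᵥ u (bestResponse θ x)

/-- Stackelberg regret of the plays `x 0, …, x (m - 1)` in one repeated game against the attacker types
`f 0, …, f (m - 1)`. The best fixed commitment in hindsight is taken as a supremum, because the utility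
is discontinuous in the commitment and its maximum over the simplex need not be attained. -/
noncomputable def stackelbergRegret {d k : ℕ} [NeZero d] (θ : Fin k → AttackerType d)
    (u : Fin d → Fin d → ℝ) (f : ℕ → Fin k) (m : ℕ) (x : ℕ → Fin d → ℝ) : ℝ :=
  sSup ((fun z => ∑ i ∈ range m, defenderUtility (θ (f i)) u z) '' stdSimplex ℝ (Fin d))
    - ∑ i ∈ range m, defenderUtility (θ (f i)) u (x i)

section Distributions

variable {S : Type*}

/-- `y` restricts to a probability distribution on the finite set `E`. -/
def IsDistribution (E : Finset S) (y : S → ℝ) : Prop :=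
  (∀ e ∈ E, 0 ≤ y e) ∧ ∑ e ∈ E, y e = 1

/-- `y` is an optimum-in-hindsight distribution on `E` for the utilities `v 0, …, v (m - 1)`. -/
def IsOptimalInHindsight (E : Finset S) (m : ℕ) (v : ℕ → S → ℝ) (y : S → ℝ) : Prop :=
  IsDistribution E y ∧ ∀ z, IsDistribution E z →
    ∑ i ∈ range m, ∑ e ∈ E, z e * v i e ≤ ∑ i ∈ range m, ∑ e ∈ E, y e * v i e

/-- Shannon entropy (natural logarithm). -/
noncomputable def shannonEntropy (E : Finset S) (y : S → ℝ) : ℝ :=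
  ∑ e ∈ E, negMulLog (y e)

/-- Kullback–Leibler divergence on `E`; it is only used for `q` positive on `E`. -/
noncomputable def klDivergence (E : Finset S) (p q : S → ℝ) : ℝ :=
  ∑ e ∈ E, p e * log (p e / q e)

/-- Multiplicative weights (Hedge) on `E` with initialization `y₀`, learning rate `η` and utilities `v`:
`mwu E y₀ η v i` is the distribution played in round `i`, the first round being round `0`. -/
noncomputable def mwu (E : Finset S) (y₀ : S → ℝ) (η : ℝ) (v : ℕ → S → ℝ) : ℕ → S → ℝ
  | 0 => y₀
  | i + 1 => fun e => mwu E y₀ η v i e * exp (η * v i e) /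
      ∑ e' ∈ E, mwu E y₀ η v i e' * exp (η * v i e')

/-- The distribution `y` moved `α`-away from the boundary: `(1 - α) y + α · uniform`. -/
noncomputable def smoothed (E : Finset S) (α : ℝ) (y : S → ℝ) : S → ℝ :=
  fun e => (1 - α) * y e + α / #E

/-- The average of the first `t` distributions of a sequence. -/
noncomputable def averageDist (y : ℕ → S → ℝ) (t : ℕ) : S → ℝ :=
  fun e => (∑ s ∈ range t, y s e) / t

/-- The boundary offset `α = 1 / √(m T)`, also used as the precision of the extreme-point set. -/
noncomputable def offset (m T : ℕ) : ℝ := 1 / √(m * T)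

/-- Initialization in task `t` (tasks are numbered from `0`): uniform in the first task, afterwards the
average of the smoothed past optima. -/
noncomputable def metaInit (E : Finset S) (m T : ℕ) (y : ℕ → S → ℝ) (t : ℕ) : S → ℝ :=
  if t = 0 then fun _ => 1 / #E else averageDist (fun s => smoothed E (offset m T) (y s)) t

/-- `D = √(log (|E| / α) / m)`. -/
noncomputable def ewooD (E : Finset S) (m T : ℕ) : ℝ := √(log (#E / offset m T) / m)

/-- `ρ = T ^ (-1/4)`. -/
noncomputable def ewooRho (T : ℕ) : ℝ := (T : ℝ) ^ (-(1 / 4) : ℝ)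

/-- `β = (2 / (m D)) min {1, ρ²}`. -/
noncomputable def ewooBeta (E : Finset S) (m T : ℕ) : ℝ :=
  2 / (m * ewooD E m T) * min 1 (ewooRho T ^ 2)

/-- The regularized regret upper bound `U_t(η) = m (η + (KL_t / m + ρ² D²) / η)` of task `t`, where
`KL_t` is the divergence of the smoothed optimum of task `t` from the initialization of task `t`. -/
noncomputable def regretSurrogate (E : Finset S) (m T : ℕ) (y : ℕ → S → ℝ) (t : ℕ) (η : ℝ) : ℝ :=
  m * (η + (klDivergence E (smoothed E (offset m T) (y t)) (metaInit E m T y t) / m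
    + ewooRho T ^ 2 * ewooD E m T ^ 2) / η)

/-- The learning rate of task `t`: exponentially weighted online optimization with parameter `β` over
`[ρ D, √(D² + ρ² D²)]`, run on the surrogates of the past tasks. -/
noncomputable def ewooRate (E : Finset S) (m T : ℕ) (y : ℕ → S → ℝ) (t : ℕ) : ℝ :=
  (∫ η in (ewooRho T * ewooD E m T)..√(ewooD E m T ^ 2 + ewooRho T ^ 2 * ewooD E m T ^ 2),
      η * exp (-ewooBeta E m T * ∑ s ∈ range t, regretSurrogate E m T y s η)) /
    ∫ η in (ewooRho T * ewooD E m T)..√(ewooD E m T ^ 2 + ewooRho T ^ 2 * ewooD E m T ^ 2),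
      exp (-ewooBeta E m T * ∑ s ∈ range t, regretSurrogate E m T y s η)

/-- Meta-learned multiplicative weights: the distribution over `E` played in round `i` of task `t`, when
`v s` are the utilities in task `s` and `y s` is the optimum in hindsight of task `s`. -/
noncomputable def metaMWU (E : Finset S) (m T : ℕ) (v : ℕ → ℕ → S → ℝ) (y : ℕ → S → ℝ)
    (t i : ℕ) : S → ℝ :=
  mwu E (metaInit E m T y t) (ewooRate E m T y t) (v t) i

/-- The random element `X` is drawn from the distribution `y` on `E`. -/
def IsDrawnFrom {Ω : Type*} [MeasurableSpace Ω] [MeasurableSpace S] (μ : Measure Ω) (X : Ω → S)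
    (E : Finset S) (y : S → ℝ) : Prop :=
  Measurable X ∧ ∀ e ∈ E, μ.real {ω | X ω = e} = y e

end Distributions

/-! The bound splits into four independent estimates.

Discretization. On a response region every attacker's answer is frozen, so the cumulative utility of
a task is linear there. Over the closed region it is maximized at an extreme point, and passing to
the representative inside the region costs `α` per round
(`IsExtremePointSet.exists_sum_defenderUtility_ge`). Replacing the optimum in hindsight by its
smoothed version costs another `2 α` per round. Up to `3 α m = 3 √(m / T)`, Stackelberg regret is
thus Hedge regret on the finite set `E`.

Within a task. With the divergence from the comparator as potential and Hoeffding's lemma for the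
normalizer, the regret is at most `KL_t / η_t + m η_t / 2` (`mul_regret_mwu_le`). Smoothing keeps
the initializations above `α / |E|`, whence `KL_t ≤ log (|E| / α) = m D²`.

Initialization. Averaging the past smoothed optima is follow-the-leader for the divergence. A
be-the-leader argument bounds the sum of the `KL_t` by `T` times the entropy of the final mean plus
a harmonic sum (`sum_klDivergence_runningMean_le`). That mean is the smoothed `ȳ`, whose entropy is
close to `H(ȳ)`.

Learning rate. The regularizer `ρ² D²` makes the surrogates exp-concave on the search interval, so
EWOO loses only `(1 + log (T + 1)) / β` against the best rate there (`sum_ewoo_le`). AM-GM passes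
from that rate to an arbitrary `η` (`sum_rate_regret_le`). A rate near `√(H / m)` balances `η m`
with `H / η` and gives the explicit bound. -/

/-! ### Response regions and their approximate extreme points -/

section Geometry

/-- A polyhedron given by finitely many homogeneous inequalities and one equation has finitely many
extreme points, because an extreme point is determined by its set of active inequalities. -/
theorem finite_extremePoints_polyhedron {V ι : Type*} [AddCommGroup V] [Module ℝ V] [Finite ι]
    (A : ι → V →ₗ[ℝ] ℝ) (l : V →ₗ[ℝ] ℝ) (c : ℝ) :
    (Set.extremePoints ℝ {x : V | l x = c ∧ ∀ i, 0 ≤ A i x}).Finite := by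
  cases nonempty_fintype ι
  refine Set.Finite.of_injOn (f := fun x => {i | A i x = 0}) (t := Set.univ)
    (Set.mapsTo_univ _ _) ?_ Set.finite_univ
  intro x hx y hy hxy
  have hact : ∀ i, A i x = 0 ↔ A i y = 0 := fun i => Set.ext_iff.1 hxy i
  obtain ⟨⟨hlx, hAx⟩, hext⟩ := mem_extremePoints_iff_left.1 hx
  obtain ⟨hly, -⟩ := hy.1
  -- Inequalities active at `x` are active at `y`, hence vanish along the line through both; the
  -- inactive ones leave room. So the segment from `y` extends beyond `x`, which extremality of `x`
  -- allows only if `y = x`.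
  have hloc : ∀ᶠ ε : ℝ in nhdsWithin 0 (Set.Ioi 0), ∀ i, 0 ≤ A i x + ε * (A i x - A i y) := by
    refine Filter.eventually_all.2 fun i => ?_
    rcases (hAx i).eq_or_lt with h | h
    · have h' := (hact i).1 h.symm
      simp [← h, h']
    · have hc : ContinuousAt (fun ε : ℝ => A i x + ε * (A i x - A i y)) 0 := by fun_prop
      have := hc.eventually (lt_mem_nhds (a := 0) (by simpa using h))
      exact (this.filter_mono nhdsWithin_le_nhds).mono fun _ h => h.le
  obtain ⟨ε, hε, hε0⟩ := (hloc.and self_mem_nhdsWithin).exists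
  have hε0 : 0 < ε := hε0
  have hz : x + ε • (x - y) ∈ {x : V | l x = c ∧ ∀ i, 0 ≤ A i x} := by
    refine ⟨by simp [hlx, hly], fun i => by simpa using hε i⟩
  have := hext y hy.1 (x + ε • (x - y)) hz ?_
  · exact this.symm
  · refine ⟨ε / (1 + ε), 1 / (1 + ε), by positivity, by positivity, by field_simp; ring, ?_⟩
    match_scalars <;> field_simp
    ring

variable {d k : ℕ}

theorem bestResponse_spec [NeZero d] (θ : AttackerType d) (x : Fin d → ℝ) :
    IsBestResponse θ x (bestResponse θ x) :=
  Classical.choose_spec (exists_isBestResponse θ x)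

theorem IsBestResponse.eq {θ : AttackerType d} {x : Fin d → ℝ} {a b : Fin d}
    (ha : IsBestResponse θ x a) (hb : IsBestResponse θ x b) : a = b := by
  have h : x ⬝ᵥ θ.payoff a = x ⬝ᵥ θ.payoff b := le_antisymm (hb.1 a) (ha.1 b)
  exact θ.priority.injective (le_antisymm (ha.2 b h.symm) (hb.2 a h))

/-- The closed polyhedron obtained from a response region by forgetting the tie-breaking. -/
def weakRegion (θ : Fin k → AttackerType d) (σ : Fin k → Fin d) : Set (Fin d → ℝ) :=
  {x | x ∈ stdSimplex ℝ (Fin d) ∧ ∀ j b, x ⬝ᵥ (θ j).payoff b ≤ x ⬝ᵥ (θ j).payoff (σ j)}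

theorem isClosed_weakRegion (θ : Fin k → AttackerType d) (σ : Fin k → Fin d) :
    IsClosed (weakRegion θ σ) := by
  refine IsClosed.and (isClosed_stdSimplex ℝ (Fin d)) ?_
  simp only [Set.ofPred_forall]
  refine isClosed_iInter fun j => isClosed_iInter fun b => ?_
  exact isClosed_le (by unfold dotProduct; fun_prop) (by unfold dotProduct; fun_prop)

theorem exists_mem_sum_abs_sub_le {P : Set (Fin d → ℝ)} {e : Fin d → ℝ} (he : e ∈ closure P)
    {γ : ℝ} (hγ : 0 < γ) : ∃ p ∈ P, ∑ i, |p i - e i| ≤ γ ∧ (e ∈ P → p = e) := by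
  by_cases heP : e ∈ P
  · exact ⟨e, heP, by simpa using hγ.le, fun _ => rfl⟩
  have hc : Continuous fun p : Fin d → ℝ => ∑ i, |p i - e i| := by fun_prop
  obtain ⟨p, hp, hpP⟩ := mem_closure_iff.1 he {p | ∑ i, |p i - e i| < γ}
    (isOpen_lt hc continuous_const) (by simpa using hγ)
  exact ⟨p, hpP, le_of_lt hp, fun h => absurd h heP⟩

/-- The maximizers of a linear functional form a compact exposed face, and an extreme point of a
face is extreme in the whole set. Convexity of `P` plays no role. -/
theorem exists_extremePoint_dotProduct_ge {P : Set (Fin d → ℝ)} (hP : IsCompact P)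
    {z : Fin d → ℝ} (hz : z ∈ P) (w : Fin d → ℝ) :
    ∃ e ∈ P.extremePoints ℝ, z ⬝ᵥ w ≤ e ⬝ᵥ w := by
  let l : StrongDual ℝ (Fin d → ℝ) :=
    LinearMap.toContinuousLinearMap ((dotProductBilin ℝ ℝ).flip w)
  have hl : ∀ x, l x = x ⬝ᵥ w := fun x => by simp [l]
  obtain ⟨x₀, hx₀, hmax⟩ := hP.exists_isMaxOn ⟨z, hz⟩ l.continuous.continuousOn
  have hexp : IsExposed ℝ P (l.toExposed P) := ContinuousLinearMap.toExposed.isExposed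
  obtain ⟨e, he⟩ := (hexp.isCompact hP).extremePoints_nonempty ⟨x₀, hx₀, fun y hy => hmax hy⟩
  refine ⟨e, hexp.isExtreme.extremePoints_subset_extremePoints he, ?_⟩
  rw [← hl, ← hl]
  exact he.1.2 z hz

theorem abs_dotProduct_le_sum_abs {x w : Fin d → ℝ} {c : ℝ} (hw : ∀ i, |w i| ≤ c) :
    |x ⬝ᵥ w| ≤ (∑ i, |x i|) * c := by
  rw [dotProduct, sum_mul]
  refine (abs_sum_le_sum_abs _ _).trans (sum_le_sum fun i _ => ?_)
  rw [abs_mul]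
  exact mul_le_mul_of_nonneg_left (hw i) (abs_nonneg _)

variable [NeZero d]

theorem bestResponse_eq_iff {θ : AttackerType d} {x : Fin d → ℝ} {a : Fin d} :
    bestResponse θ x = a ↔ IsBestResponse θ x a :=
  ⟨fun h => h ▸ bestResponse_spec θ x, fun h => (bestResponse_spec θ x).eq h⟩

theorem responseRegion_subset_weakRegion (θ : Fin k → AttackerType d) (σ : Fin k → Fin d) :
    responseRegion θ σ ⊆ weakRegion θ σ :=
  fun _ hx => ⟨hx.1, fun j => (bestResponse_eq_iff.1 (hx.2 j)).1⟩

theorem responseRegion_subset_stdSimplex (θ : Fin k → AttackerType d) (σ : Fin k → Fin d) :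
    responseRegion θ σ ⊆ stdSimplex ℝ (Fin d) := fun _ hx => hx.1

/-- Since `p` carries positive weight, a tie at an interior point of the segment forces a tie at
`p`, where the priority already favours `σ j`. Hence tie-breaking is invisible to the closure of a
nonempty region. -/
theorem openSegment_subset_responseRegion {θ : Fin k → AttackerType d} {σ : Fin k → Fin d}
    {p z : Fin d → ℝ} (hp : p ∈ responseRegion θ σ) (hz : z ∈ weakRegion θ σ) :
    openSegment ℝ p z ⊆ responseRegion θ σ := by
  rintro x ⟨a, b, ha, hb, hab, rfl⟩
  refine ⟨convex_stdSimplex ℝ (Fin d) hp.1 hz.1 ha.le hb.le hab, fun j => ?_⟩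
  have hpj := bestResponse_eq_iff.1 (hp.2 j)
  refine bestResponse_eq_iff.2 ⟨fun c => ?_, fun c hc => hpj.2 c ?_⟩
  · simp only [add_dotProduct, smul_dotProduct, smul_eq_mul]
    have h1 := mul_le_mul_of_nonneg_left (hpj.1 c) ha.le
    have h2 := mul_le_mul_of_nonneg_left (hz.2 j c) hb.le
    linarith
  · simp only [add_dotProduct, smul_dotProduct, smul_eq_mul] at hc
    have h2 := mul_le_mul_of_nonneg_left (hz.2 j c) hb.le
    refine le_antisymm (hpj.1 c) (le_of_mul_le_mul_left ?_ ha)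
    linarith

theorem closure_responseRegion {θ : Fin k → AttackerType d} {σ : Fin k → Fin d}
    (h : (responseRegion θ σ).Nonempty) : closure (responseRegion θ σ) = weakRegion θ σ := by
  obtain ⟨p, hp⟩ := h
  refine Set.Subset.antisymm (closure_minimal (responseRegion_subset_weakRegion θ σ)
    (isClosed_weakRegion θ σ)) fun z hz => ?_
  have h1 := closure_mono (openSegment_subset_responseRegion hp hz)
  rw [closure_openSegment] at h1
  exact h1 (right_mem_segment ℝ p z)

/-- A nonempty region has as closure the polyhedron cut out by the coordinate signs, the payoff
differences and the equation that the coordinates sum to one. -/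
theorem finite_extremePoints_closure_responseRegion (θ : Fin k → AttackerType d)
    (σ : Fin k → Fin d) : ((closure (responseRegion θ σ)).extremePoints ℝ).Finite := by
  rcases (responseRegion θ σ).eq_empty_or_nonempty with h | h
  · simp [h]
  rw [closure_responseRegion h]
  let A : Fin d ⊕ (Fin k × Fin d) → (Fin d → ℝ) →ₗ[ℝ] ℝ := Sum.elim
    (fun i => LinearMap.proj i)
    (fun q => dotProductBilin ℝ ℝ |>.flip ((θ q.1).payoff (σ q.1) - (θ q.1).payoff q.2))
  have h : weakRegion θ σ = {x | (∑ i, LinearMap.proj i : (Fin d → ℝ) →ₗ[ℝ] ℝ) x = 1 ∧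
      ∀ i, 0 ≤ A i x} := by
    ext x
    simp [weakRegion, stdSimplex, A, and_assoc, and_comm]
  rw [h]
  exact finite_extremePoints_polyhedron A _ 1

theorem isCompact_closure_responseRegion (θ : Fin k → AttackerType d) (σ : Fin k → Fin d) :
    IsCompact (closure (responseRegion θ σ)) :=
  (isCompact_stdSimplex ℝ (Fin d)).of_isClosed_subset isClosed_closure
    (closure_minimal (responseRegion_subset_stdSimplex θ σ) (isClosed_stdSimplex ℝ (Fin d)))

theorem exists_isExtremePointSet (θ : Fin k → AttackerType d) {γ : ℝ} (hγ : 0 < γ) :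
    ∃ E, IsExtremePointSet θ γ E := by
  have h : ∀ σ e, ∃ p, e ∈ (closure (responseRegion θ σ)).extremePoints ℝ →
      p ∈ responseRegion θ σ ∧ ∑ i, |p i - e i| ≤ γ ∧ (e ∈ responseRegion θ σ → p = e) := by
    intro σ e
    by_cases he : e ∈ (closure (responseRegion θ σ)).extremePoints ℝ
    · obtain ⟨p, hp⟩ := exists_mem_sum_abs_sub_le (extremePoints_subset he) hγ
      exact ⟨p, fun _ => hp⟩
    · exact ⟨e, fun h => absurd h he⟩
  choose rep hrep using h
  exact ⟨_, rep, fun σ e he => hrep σ e he, rfl⟩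

theorem IsExtremePointSet.finite {θ : Fin k → AttackerType d} {γ : ℝ} {E : Set (Fin d → ℝ)}
    (hE : IsExtremePointSet θ γ E) : E.Finite := by
  obtain ⟨rep, -, rfl⟩ := hE
  have : {p | ∃ σ, ∃ e ∈ (closure (responseRegion θ σ)).extremePoints ℝ, rep σ e = p} =
      ⋃ σ, rep σ '' (closure (responseRegion θ σ)).extremePoints ℝ := by
    ext p; simp
  rw [this]
  exact Set.finite_iUnion fun σ =>
    (finite_extremePoints_closure_responseRegion θ σ).image _

theorem mem_responseRegion_bestResponse (θ : Fin k → AttackerType d) {z : Fin d → ℝ}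
    (hz : z ∈ stdSimplex ℝ (Fin d)) : z ∈ responseRegion θ fun j => bestResponse (θ j) z :=
  ⟨hz, fun _ => rfl⟩

theorem IsExtremePointSet.nonempty {θ : Fin k → AttackerType d} {γ : ℝ} {E : Set (Fin d → ℝ)}
    (hE : IsExtremePointSet θ γ E) : E.Nonempty := by
  obtain ⟨rep, -, rfl⟩ := hE
  have hz := mem_responseRegion_bestResponse θ (single_mem_stdSimplex ℝ (0 : Fin d))
  obtain ⟨e, he⟩ := (isCompact_closure_responseRegion θ _).extremePoints_nonempty
    ⟨_, subset_closure hz⟩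
  exact ⟨_, _, e, he, rfl⟩

theorem IsExtremePointSet.subset_stdSimplex {θ : Fin k → AttackerType d} {γ : ℝ}
    {E : Set (Fin d → ℝ)} (hE : IsExtremePointSet θ γ E) : E ⊆ stdSimplex ℝ (Fin d) := by
  obtain ⟨rep, h, rfl⟩ := hE
  rintro _ ⟨σ, e, he, rfl⟩
  exact (h σ e he).1.1

theorem abs_defenderUtility_le_one {θ : AttackerType d} {u : Fin d → Fin d → ℝ}
    (hu : ∀ a i, |u a i| ≤ 1) {x : Fin d → ℝ} (hx : x ∈ stdSimplex ℝ (Fin d)) :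
    |defenderUtility θ u x| ≤ 1 := by
  refine (abs_dotProduct_le_sum_abs (hu _)).trans ?_
  rw [mul_one, sum_congr rfl fun i _ => abs_of_nonneg (hx.1 i), hx.2]

/-- Restricting the defender to a set of approximate extreme points costs at most `γ` per round. -/
theorem IsExtremePointSet.exists_sum_defenderUtility_ge {θ : Fin k → AttackerType d} {γ : ℝ}
    {E : Set (Fin d → ℝ)} (hE : IsExtremePointSet θ γ E) {u : Fin d → Fin d → ℝ}
    (hu : ∀ a i, |u a i| ≤ 1) (f : ℕ → Fin k) (m : ℕ) {z : Fin d → ℝ}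
    (hz : z ∈ stdSimplex ℝ (Fin d)) :
    ∃ p ∈ E, ∑ i ∈ range m, defenderUtility (θ (f i)) u z ≤
      ∑ i ∈ range m, defenderUtility (θ (f i)) u p + γ * m := by
  obtain ⟨rep, h, rfl⟩ := hE
  set σ : Fin k → Fin d := fun j => bestResponse (θ j) z with hσ
  have hzσ : z ∈ responseRegion θ σ := mem_responseRegion_bestResponse θ hz
  -- Linearity holds only inside the region, not at the extreme point `e` itself; this is why the
  -- representative must lie in the region.
  have hlin : ∀ x ∈ responseRegion θ σ, ∑ i ∈ range m, defenderUtility (θ (f i)) u x =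
      x ⬝ᵥ ∑ i ∈ range m, u (σ (f i)) := by
    intro x hx
    rw [dotProduct_sum]
    refine sum_congr rfl fun i _ => ?_
    rw [defenderUtility, hx.2]
  obtain ⟨e, he, hle⟩ := exists_extremePoint_dotProduct_ge (isCompact_closure_responseRegion θ σ)
    (subset_closure hzσ) (∑ i ∈ range m, u (σ (f i)))
  obtain ⟨hp, hdist, -⟩ := h σ e he
  refine ⟨_, ⟨σ, e, he, rfl⟩, ?_⟩
  rw [hlin z hzσ, hlin _ hp]
  have hw : ∀ i, |(∑ s ∈ range m, u (σ (f s))) i| ≤ m := by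
    intro i
    rw [Finset.sum_apply]
    refine (abs_sum_le_sum_abs _ _).trans ((sum_le_sum fun s _ => hu _ i).trans ?_)
    simp
  have h1 := abs_dotProduct_le_sum_abs (x := rep σ e - e) hw
  have h2 : (∑ i, |(rep σ e - e) i|) * (m : ℝ) ≤ γ * m :=
    mul_le_mul_of_nonneg_right hdist (Nat.cast_nonneg m)
  rw [sub_dotProduct] at h1
  have := neg_le_of_abs_le h1
  linarith

end Geometry

/-! ### Hedge with an arbitrary initialization -/

section Distributions

variable {S : Type*} {E : Finset S}

/-- Hoeffding's lemma for the discrete measure with weights `q`; values in `[-1, 1]` give variance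
proxy one. -/
theorem sum_mul_exp_le_exp {q v : S → ℝ} (hq : IsDistribution E q) (hv : ∀ e ∈ E, |v e| ≤ 1)
    (η : ℝ) : ∑ e ∈ E, q e * exp (η * v e) ≤ exp (η * ∑ e ∈ E, q e * v e + η ^ 2 / 2) := by
  let _ : MeasurableSpace S := ⊤
  let μ : Measure S := ∑ e ∈ E, ENNReal.ofReal (q e) • Measure.dirac e
  have hint : ∀ g : S → ℝ, ∫ x, g x ∂μ = ∑ e ∈ E, q e * g e := by
    intro g
    rw [integral_finsetSum_measure]
    · refine sum_congr rfl fun e he => ?_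
      rw [integral_smul_measure, integral_dirac, ENNReal.toReal_ofReal (hq.1 e he), smul_eq_mul]
    · intro e _
      exact (integrable_dirac (by simp)).smul_measure ENNReal.ofReal_ne_top
  have hμ : IsProbabilityMeasure μ := by
    constructor
    simp only [μ, Measure.coe_finsetSum, Finset.sum_apply, Measure.smul_apply, measure_univ,
      smul_eq_mul, mul_one]
    rw [← ENNReal.ofReal_sum_of_nonneg hq.1, hq.2, ENNReal.ofReal_one]
  have hb : ∀ᵐ x ∂μ, v x ∈ Set.Icc (-1 : ℝ) 1 := by
    rw [ae_iff]
    simp only [μ, Measure.coe_finsetSum, Finset.sum_apply, Measure.smul_apply, smul_eq_mul]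
    refine sum_eq_zero fun e he => ?_
    rw [Measure.dirac_apply' _ MeasurableSpace.measurableSet_top, Set.indicator_of_notMem, mul_zero]
    simpa using abs_le.1 (hv e he)
  have h := (ProbabilityTheory.hasSubgaussianMGF_of_mem_Icc (X := v) (μ := μ)
    measurable_from_top.aemeasurable hb).mgf_le η
  rw [ProbabilityTheory.mgf, hint, hint] at h
  have hc : ((((‖(1 : ℝ) - -1‖₊ / 2) ^ 2 : NNReal) : ℝ)) = 1 := by
    push_cast
    norm_num
  rw [hc, one_mul] at h
  rw [exp_add, ← div_le_iff₀' (exp_pos _), sum_div]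
  refine le_of_eq_of_le (sum_congr rfl fun e _ => ?_) h
  rw [mul_sub, exp_sub, mul_div_assoc]

theorem sum_exp_pos (hE : E.Nonempty) {q : S → ℝ} (hq : ∀ e ∈ E, 0 < q e) (w : S → ℝ) :
    0 < ∑ e ∈ E, q e * exp (w e) :=
  sum_pos (fun e he => mul_pos (hq e he) (exp_pos _)) hE

theorem mwu_pos (hE : E.Nonempty) {y₀ : S → ℝ} (h₀ : ∀ e ∈ E, 0 < y₀ e) (η : ℝ)
    (v : ℕ → S → ℝ) (i : ℕ) : ∀ e ∈ E, 0 < mwu E y₀ η v i e := by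
  induction i with
  | zero => exact h₀
  | succ i ih =>
    exact fun e he => div_pos (mul_pos (ih e he) (exp_pos _)) (sum_exp_pos hE ih _)

theorem isDistribution_mwu (hE : E.Nonempty) {y₀ : S → ℝ} (hp : ∀ e ∈ E, 0 < y₀ e)
    (h₀ : ∑ e ∈ E, y₀ e = 1) (η : ℝ)
    (v : ℕ → S → ℝ) (i : ℕ) : IsDistribution E (mwu E y₀ η v i) := by
  refine ⟨fun e he => (mwu_pos hE hp η v i e he).le, ?_⟩
  cases i with
  | zero => exact h₀
  | succ i =>
    simp only [mwu]
    rw [← sum_div, div_self (sum_exp_pos hE (mwu_pos hE hp η v i) _).ne']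

/-- Gibbs' inequality. -/
theorem klDivergence_nonneg {p q : S → ℝ} (hp : IsDistribution E p) (hq : ∀ e ∈ E, 0 < q e)
    (hq1 : ∑ e ∈ E, q e = 1) : 0 ≤ klDivergence E p q := by
  have h : ∑ e ∈ E, (p e - q e) ≤ klDivergence E p q := by
    refine sum_le_sum fun e he => ?_
    rcases (hp.1 e he).eq_or_lt with h0 | h0
    · simp [← h0, (hq e he).le]
    · have := log_le_sub_one_of_pos (div_pos (hq e he) h0)
      have h2 : log (p e / q e) = - log (q e / p e) := by rw [← log_inv, inv_div]
      rw [h2]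
      have h3 := mul_le_mul_of_nonneg_left this h0.le
      rw [mul_sub, mul_div_cancel₀ _ h0.ne'] at h3
      linarith
  rwa [sum_sub_distrib, hp.2, hq1, sub_self] at h

/-- The entropy of `p` cancels, so the divergence from a fixed comparator can serve as a telescoping
potential. -/
theorem klDivergence_eq_sub {p q r : S → ℝ} (hp : IsDistribution E p) (hq : ∀ e ∈ E, 0 < q e)
    (hr : ∀ e ∈ E, 0 < r e) :
    klDivergence E p q - klDivergence E p r = ∑ e ∈ E, p e * (log (r e) - log (q e)) := by
  rw [klDivergence, klDivergence, ← sum_sub_distrib]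
  refine sum_congr rfl fun e he => ?_
  rcases (hp.1 e he).eq_or_lt with h0 | h0
  · simp [← h0]
  · rw [log_div h0.ne' (hq e he).ne', log_div h0.ne' (hr e he).ne']
    ring

/-- Regret of multiplicative weights with an arbitrary positive initialization. -/
theorem mul_regret_mwu_le (hE : E.Nonempty) {y₀ : S → ℝ} (hpos : ∀ e ∈ E, 0 < y₀ e)
    (h₀ : ∑ e ∈ E, y₀ e = 1) {v : ℕ → S → ℝ} {m : ℕ}
    (hv : ∀ i < m, ∀ e ∈ E, |v i e| ≤ 1) {p : S → ℝ} (hp : IsDistribution E p) (η : ℝ) :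
    η * ∑ i ∈ range m, (∑ e ∈ E, p e * v i e - ∑ e ∈ E, mwu E y₀ η v i e * v i e) ≤
      klDivergence E p y₀ + m * (η ^ 2 / 2) := by
  -- In each round the potential drops by `η ⟨p, v⟩` minus the log-normalizer, which is at most `η
  -- ⟨y, v⟩ + η² / 2`.
  have key : ∀ n ≤ m,
      η * ∑ i ∈ range n, (∑ e ∈ E, p e * v i e - ∑ e ∈ E, mwu E y₀ η v i e * v i e) ≤
      klDivergence E p y₀ - klDivergence E p (mwu E y₀ η v n) + n * (η ^ 2 / 2) := by
    intro n hn
    induction n with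
    | zero => simp [mwu]
    | succ n ih =>
      have ih := ih (by omega)
      have hy := mwu_pos hE hpos η v n
      have hy' := mwu_pos hE hpos η v (n + 1)
      have hd := isDistribution_mwu hE hpos h₀ η v n
      have hZ := sum_exp_pos hE hy (fun e => η * v n e)
      have hlog := log_le_log hZ (sum_mul_exp_le_exp hd (hv n (by omega)) η)
      rw [log_exp] at hlog
      have hsub := klDivergence_eq_sub hp hy hy'
      have hstep : ∀ e ∈ E, p e * (log (mwu E y₀ η v (n + 1) e) - log (mwu E y₀ η v n e)) =
          η * (p e * v n e) - p e * log (∑ e' ∈ E, mwu E y₀ η v n e' * exp (η * v n e')) := by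
        intro e he
        rw [mwu, log_div (mul_pos (hy e he) (exp_pos _)).ne' hZ.ne',
          log_mul (hy e he).ne' (exp_pos _).ne', log_exp]
        ring
      rw [sum_congr rfl hstep, sum_sub_distrib, ← sum_mul, ← mul_sum, hp.2, one_mul] at hsub
      rw [sum_range_succ, mul_add, mul_sub]
      push_cast
      linarith
  have := key m le_rfl
  have hg := klDivergence_nonneg hp (mwu_pos hE hpos η v m)
    (isDistribution_mwu hE hpos h₀ η v m).2
  linarith

end Distributions

/-! ### Exponentially weighted online optimization -/

section ExponentiallyWeighted

theorem concaveOn_of_supergradient {s : Set ℝ} (hs : Convex ℝ s) {g : ℝ → ℝ}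
    (hg : ∀ y ∈ s, ∃ c, ∀ x ∈ s, g x ≤ g y + c * (x - y)) : ConcaveOn ℝ s g := by
  refine ⟨hs, fun x hx z hz a b ha hb hab => ?_⟩
  obtain ⟨c, hc⟩ := hg _ (hs hx hz ha hb hab)
  have h1 := mul_le_mul_of_nonneg_left (hc x hx) ha
  have h2 := mul_le_mul_of_nonneg_left (hc z hz) hb
  simp only [smul_eq_mul] at *
  obtain rfl : b = 1 - a := by linarith
  nlinarith

/-- The weighted mean of the identity over an interval lies in the interval. -/
theorem weighted_mean_mem_Icc {a b : ℝ} (hab : a < b) {F : ℝ → ℝ}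
    (hF : ContinuousOn F (Set.Icc a b)) (hpos : ∀ x ∈ Set.Icc a b, 0 < F x) :
    (∫ x in a..b, x * F x) / (∫ x in a..b, F x) ∈ Set.Icc a b := by
  have hFi : IntervalIntegrable F volume a b := hF.intervalIntegrable_of_Icc hab.le
  have hxFi : IntervalIntegrable (fun x => x * F x) volume a b :=
    (continuousOn_id.mul hF).intervalIntegrable_of_Icc hab.le
  have hW : 0 < ∫ x in a..b, F x :=
    intervalIntegral.intervalIntegral_pos_of_pos_on hFi
      (fun x hx => hpos x (Set.Ioo_subset_Icc_self hx)) hab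
  rw [Set.mem_Icc, le_div_iff₀ hW, div_le_iff₀ hW, ← intervalIntegral.integral_const_mul,
    ← intervalIntegral.integral_const_mul]
  exact ⟨intervalIntegral.integral_mono_on hab.le (hFi.const_mul _) hxFi fun x hx =>
      mul_le_mul_of_nonneg_right hx.1 (hpos x hx).le,
    intervalIntegral.integral_mono_on hab.le hxFi (hFi.const_mul _) fun x hx =>
      mul_le_mul_of_nonneg_right hx.2 (hpos x hx).le⟩

/-- Jensen's inequality for a weighted mean over an interval. -/
theorem integral_mul_le_of_supergradient {a b : ℝ} (hab : a < b) {F g : ℝ → ℝ}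
    (hF : ContinuousOn F (Set.Icc a b)) (hpos : ∀ x ∈ Set.Icc a b, 0 < F x)
    (hgc : ContinuousOn g (Set.Icc a b))
    (hg : ∀ y ∈ Set.Icc a b, ∃ c, ∀ x ∈ Set.Icc a b, g x ≤ g y + c * (x - y)) :
    ∫ x in a..b, F x * g x ≤
      (∫ x in a..b, F x) * g ((∫ x in a..b, x * F x) / ∫ x in a..b, F x) := by
  have hFi : IntervalIntegrable F volume a b := hF.intervalIntegrable_of_Icc hab.le
  have hxFi : IntervalIntegrable (fun x => x * F x) volume a b :=
    (continuousOn_id.mul hF).intervalIntegrable_of_Icc hab.le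
  have hW : 0 < ∫ x in a..b, F x :=
    intervalIntegral.intervalIntegral_pos_of_pos_on hFi
      (fun x hx => hpos x (Set.Ioo_subset_Icc_self hx)) hab
  set y := (∫ x in a..b, x * F x) / ∫ x in a..b, F x with hy
  -- The supergradient is taken at the weighted mean, so its linear part integrates to zero against
  -- `F`.
  obtain ⟨c, hc⟩ := hg y (weighted_mean_mem_Icc hab hF hpos)
  calc ∫ x in a..b, F x * g x
      ≤ ∫ x in a..b, ((g y - c * y) * F x + c * (x * F x)) := by
        refine intervalIntegral.integral_mono_on hab.le
          ((hF.mul hgc).intervalIntegrable_of_Icc hab.le)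
          ((hFi.const_mul _).add (hxFi.const_mul _)) fun x hx => ?_
        have := mul_le_mul_of_nonneg_left (hc x hx) (hpos x hx).le
        linarith
    _ = (g y - c * y) * (∫ x in a..b, F x) + c * (∫ x in a..b, x * F x) := by
        rw [intervalIntegral.integral_add (hFi.const_mul _) (hxFi.const_mul _),
          intervalIntegral.integral_const_mul, intervalIntegral.integral_const_mul]
    _ = (∫ x in a..b, F x) * g y := by
        have : ∫ x in a..b, x * F x = y * ∫ x in a..b, F x := by
          rw [hy, div_mul_cancel₀ _ hW.ne']
        rw [this]
        ring

/-- This is `(1 + 1 / T) ^ T ≤ e` inverted. It bounds the product of the factors `T / (T + 1)` lost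
once per task. -/
theorem exp_neg_one_le_ratio_pow (T : ℕ) : exp (-1) ≤ ((T : ℝ) / (T + 1)) ^ T := by
  rcases Nat.eq_zero_or_pos T with rfl | hT
  · simp
  have hT' : (0 : ℝ) < T := by exact_mod_cast hT
  have h1 : (1 + 1 / (T : ℝ)) ^ T ≤ exp 1 := by
    calc (1 + 1 / (T : ℝ)) ^ T ≤ (exp (1 / T)) ^ T :=
          pow_le_pow_left₀ (by positivity) (by linarith [add_one_le_exp (1 / (T : ℝ))]) _
      _ = exp 1 := by rw [← exp_nat_mul, mul_one_div_cancel hT'.ne']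
  have h2 : (T : ℝ) / (T + 1) = (1 + 1 / (T : ℝ))⁻¹ := by field_simp
  rw [h2, inv_pow, exp_neg]
  exact inv_anti₀ (by positivity) h1

/-- Regret of exponentially weighted online optimization over `[a, b]` for losses whose exponentials
`exp (-β U)` satisfy the supergradient inequality. -/
theorem sum_ewoo_le {a b β : ℝ} (hab : a < b) (hβ : 0 < β) (T : ℕ) (U : ℕ → ℝ → ℝ)
    (hU : ∀ t < T, ContinuousOn (U t) (Set.Icc a b))
    (hg : ∀ t < T, ∀ y ∈ Set.Icc a b, ∃ c, ∀ x ∈ Set.Icc a b,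
      exp (-β * U t x) ≤ exp (-β * U t y) + c * (x - y))
    (η : ℕ → ℝ)
    (hη : ∀ t < T, η t = (∫ x in a..b, x * exp (-β * ∑ s ∈ range t, U s x)) /
      ∫ x in a..b, exp (-β * ∑ s ∈ range t, U s x))
    {x : ℝ} (hx : x ∈ Set.Icc a b) :
    ∑ t ∈ range T, U t (η t) ≤ ∑ t ∈ range T, U t x + (1 + log (T + 1)) / β := by
  have hFc : ∀ t ≤ T, ContinuousOn (fun x => exp (-β * ∑ s ∈ range t, U s x)) (Set.Icc a b) := by
    intro t ht
    refine (continuousOn_const.mul (continuousOn_finsetSum _ fun s hs => hU s ?_)).rexp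
    have := mem_range.1 hs
    omega
  have hWpos : ∀ t ≤ T, 0 < ∫ x in a..b, exp (-β * ∑ s ∈ range t, U s x) := fun t ht =>
    intervalIntegral.intervalIntegral_pos_of_pos_on
      ((hFc t ht).intervalIntegrable_of_Icc hab.le) (fun x _ => exp_pos _) hab
  -- By Jensen, each task multiplies the total weight by at most `exp (-β U_t(η_t))`.
  have hupper : ∀ t ≤ T, ∫ x in a..b, exp (-β * ∑ s ∈ range t, U s x) ≤
      (b - a) * exp (-β * ∑ s ∈ range t, U s (η s)) := by
    intro t ht
    induction t with
    | zero => simp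
    | succ t ih =>
      have hj := integral_mul_le_of_supergradient hab (hFc t (by omega)) (fun _ _ => exp_pos _)
        (g := fun x => exp (-β * U t x)) (continuousOn_const.mul (hU t (by omega))).rexp
        (hg t (by omega))
      rw [← hη t (by omega)] at hj
      simp only [sum_range_succ, mul_add, exp_add]
      refine hj.trans ?_
      rw [← mul_assoc]
      exact mul_le_mul_of_nonneg_right (ih (by omega)) (exp_pos _).le
  have hT1 : (0 : ℝ) < T + 1 := by positivity
  have hlower : (b - a) / (T + 1) * (exp (-1) * exp (-β * ∑ s ∈ range T, U s x)) ≤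
      ∫ x in a..b, exp (-β * ∑ s ∈ range T, U s x) := by
    -- `[a', b']` is the interval shrunk towards `x` by the factor `1 / (T + 1)`. Its points are `(T
    -- x + z) / (T + 1)` with `z ∈ [a, b]`, so concavity of `exp (-β U_t)` retains a `T / (T + 1)`
    -- share of the value at `x`.
    set a' := (T * x + a) / (T + 1) with ha'
    set b' := (T * x + b) / (T + 1) with hb'
    have haa : a ≤ a' := by
      rw [ha', le_div_iff₀ hT1]
      nlinarith [hx.1, (Nat.cast_nonneg T : (0 : ℝ) ≤ T)]
    have hbb : b' ≤ b := by
      rw [hb', div_le_iff₀ hT1]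
      nlinarith [hx.2, (Nat.cast_nonneg T : (0 : ℝ) ≤ T)]
    have hab' : a' ≤ b' := div_le_div_of_nonneg_right (by linarith) hT1.le
    have hlen : b' - a' = (b - a) / (T + 1) := by
      rw [ha', hb', ← sub_div]
      congr 1
      ring
    have hpt : ∀ w ∈ Set.Icc a' b', exp (-1) * exp (-β * ∑ s ∈ range T, U s x) ≤
        exp (-β * ∑ s ∈ range T, U s w) := by
      intro w hw
      have hz : (T + 1) * w - T * x ∈ Set.Icc a b := by
        have h1 := (div_le_iff₀ hT1).1 hw.1
        have h2 := (le_div_iff₀ hT1).1 hw.2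
        constructor <;> linarith
      have hstep : ∀ t ∈ range T, (T : ℝ) / (T + 1) * exp (-β * U t x) ≤ exp (-β * U t w) := by
        intro t ht
        have hc := (concaveOn_of_supergradient (convex_Icc a b) (hg t (mem_range.1 ht))).2 hx hz
          (show (0 : ℝ) ≤ T / (T + 1) by positivity) (show (0 : ℝ) ≤ 1 / (T + 1) by positivity)
          (by field_simp)
        have hw' : ((T : ℝ) / (T + 1)) • x + (1 / ((T : ℝ) + 1)) • ((T + 1) * w - T * x) = w := by
          simp only [smul_eq_mul]
          field_simp
          ring
        rw [hw'] at hc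
        refine le_trans ?_ hc
        simp only [smul_eq_mul]
        have : 0 ≤ 1 / ((T : ℝ) + 1) * exp (-β * U t ((T + 1) * w - T * x)) := by positivity
        linarith
      have hprod := prod_le_prod (fun t _ => by positivity) hstep
      rw [prod_mul_distrib, prod_const, card_range, ← exp_sum, ← exp_sum, ← mul_sum,
        ← mul_sum] at hprod
      exact (mul_le_mul_of_nonneg_right (exp_neg_one_le_ratio_pow T) (exp_pos _).le).trans hprod
    have hi := (hFc T le_rfl).intervalIntegrable_of_Icc (μ := volume) hab.le
    calc (b - a) / (T + 1) * (exp (-1) * exp (-β * ∑ s ∈ range T, U s x))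
        = ∫ _ in a'..b', exp (-1) * exp (-β * ∑ s ∈ range T, U s x) := by
          rw [intervalIntegral.integral_const, hlen, smul_eq_mul]
      _ ≤ ∫ w in a'..b', exp (-β * ∑ s ∈ range T, U s w) := by
          refine intervalIntegral.integral_mono_on hab' intervalIntegrable_const ?_ hpt
          exact ((hFc T le_rfl).mono (Set.Icc_subset_Icc haa hbb)).intervalIntegrable_of_Icc hab'
      _ ≤ ∫ w in a..b, exp (-β * ∑ s ∈ range T, U s w) :=
          intervalIntegral.integral_mono_interval haa hab' hbb
            (Filter.Eventually.of_forall fun _ => (exp_pos _).le) hi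
  have h := hlower.trans (hupper T le_rfl)
  rw [div_mul_eq_mul_div, mul_div_assoc] at h
  have h := le_of_mul_le_mul_left h (sub_pos.2 hab)
  have h := log_le_log (by positivity) h
  rw [log_div (by positivity) hT1.ne', log_mul (exp_pos _).ne' (exp_pos _).ne', log_exp, log_exp,
    log_exp] at h
  rw [← sub_le_iff_le_add', le_div_iff₀ hβ]
  linarith

/-- Exponential concavity of `η ↦ m (η + c / η)` in the form of a supergradient inequality. -/
theorem exists_supergradient_exp {m c β a b : ℝ} (ha : 0 < a)
    (hc : ∀ η ∈ Set.Icc a b, β * m ^ 2 * (1 - c / η ^ 2) ^ 2 ≤ m * (2 * c / η ^ 3)) (hβ : 0 ≤ β) :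
    ∀ y ∈ Set.Icc a b, ∃ s, ∀ x ∈ Set.Icc a b,
      exp (-β * (m * (x + c / x))) ≤ exp (-β * (m * (y + c / y))) + s * (x - y) := by
  set g : ℝ → ℝ := fun x => exp (-β * (m * (x + c / x))) with hg
  set g' : ℝ → ℝ := fun x => g x * (-β * (m * (1 - c / x ^ 2))) with hg'
  set g'' : ℝ → ℝ := fun x => g' x * (-β * (m * (1 - c / x ^ 2))) +
    g x * (-β * (m * (2 * c / x ^ 3))) with hg''
  have hd : ∀ x ∈ Set.Icc a b, HasDerivAt g (g' x) x := by
    intro x hx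
    have hx0 : x ≠ 0 := (ha.trans_le hx.1).ne'
    have h1 : HasDerivAt (fun x => -β * (m * (x + c / x))) (-β * (m * (1 - c / x ^ 2))) x := by
      exact ((((hasDerivAt_id' x).fun_add ((hasDerivAt_const x c).fun_div (hasDerivAt_id' x) hx0)
        ).const_mul m).const_mul (-β)).congr_deriv (by field_simp; ring)
    exact h1.exp
  have hd' : ∀ x ∈ Set.Icc a b, HasDerivAt g' (g'' x) x := by
    intro x hx
    have hx0 : x ≠ 0 := (ha.trans_le hx.1).ne'
    refine (hd x hx).mul ?_
    exact (((((hasDerivAt_const x c).fun_div (hasDerivAt_pow 2 x) (pow_ne_zero 2 hx0)).const_sub 1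
      ).const_mul m).const_mul (-β)).congr_deriv (by push_cast; field_simp; ring)
  -- The second derivative has the sign of `β U'² - U''`, which `hc` makes nonpositive.
  have hneg : ∀ x ∈ Set.Icc a b, g'' x ≤ 0 := by
    intro x hx
    have : g'' x = g x * β * (β * m ^ 2 * (1 - c / x ^ 2) ^ 2 - m * (2 * c / x ^ 3)) := by
      simp only [hg'', hg']
      ring
    rw [this]
    exact mul_nonpos_of_nonneg_of_nonpos (mul_nonneg (exp_pos _).le hβ) (by linarith [hc x hx])
  have hconc : ConcaveOn ℝ (Set.Icc a b) g :=
    concaveOn_of_hasDerivWithinAt2_nonpos (convex_Icc a b)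
      (fun x hx => (hd x hx).continuousAt.continuousWithinAt)
      (fun x hx => (hd x (interior_subset hx)).hasDerivWithinAt)
      (fun x hx => (hd' x (interior_subset hx)).hasDerivWithinAt)
      (fun x hx => hneg x (interior_subset hx))
  intro y hy
  refine ⟨g' y, fun x hx => ?_⟩
  change g x ≤ g y + g' y * (x - y)
  rcases lt_trichotomy x y with h | rfl | h
  · have := hconc.le_slope_of_hasDerivAt hx hy h (hd y hy)
    rw [slope_def_field, le_div_iff₀ (sub_pos.2 h)] at this
    linarith
  · simp
  · have := hconc.slope_le_of_hasDerivAt hy hx h (hd y hy)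
    rw [slope_def_field, div_le_iff₀ (sub_pos.2 h)] at this
    linarith

/-- The curvature inequality behind the exponential concavity of the regret surrogates. -/
theorem mul_sq_sub_le {r s c : ℝ} (hr : 0 < r) (hr1 : r ≤ 1) (hs : r ≤ s)
    (hs1 : s ^ 2 ≤ 1 + r ^ 2) (hc : r ^ 2 ≤ c) (hc1 : c ≤ 1 + r ^ 2) :
    r ^ 2 * (s ^ 2 - c) ^ 2 ≤ c * s := by
  have hrs : r ^ 2 ≤ s ^ 2 := pow_le_pow_left₀ hr.le hs 2
  have hs0 : 0 < s := hr.trans_le hs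
  have hc0 : 0 < c := (pow_pos hr 2).trans_le hc
  -- Both `s ^ 2` and `c` lie in `[r ^ 2, 1 + r ^ 2]`, so they differ by at most one and the square
  -- of the difference is at most its absolute value.
  rcases le_total (s ^ 2) c with h | h
  · have h1 : (s ^ 2 - c) ^ 2 ≤ c := by nlinarith
    calc r ^ 2 * (s ^ 2 - c) ^ 2 ≤ r ^ 2 * c := by gcongr
      _ ≤ s * c := by
        refine mul_le_mul_of_nonneg_right ?_ hc0.le
        nlinarith
      _ = c * s := mul_comm _ _
  · have h1 : (s ^ 2 - c) ^ 2 ≤ s := by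
      rcases le_total s 1 with h1 | h1
      · have h2 : s ^ 2 ≤ s := by nlinarith
        nlinarith
      · nlinarith
    calc r ^ 2 * (s ^ 2 - c) ^ 2 ≤ r ^ 2 * s := by gcongr
      _ ≤ c * s := by gcongr

end ExponentiallyWeighted

/-! ### Entropy bounds for the averaged initialization -/

section Entropy

variable {S : Type*} {E : Finset S}

theorem IsDistribution.le_one {p : S → ℝ} (hp : IsDistribution E p) {e : S} (he : e ∈ E) :
    p e ≤ 1 :=
  hp.2 ▸ single_le_sum hp.1 he

theorem IsDistribution.nonempty {p : S → ℝ} (hp : IsDistribution E p) : E.Nonempty := by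
  rw [nonempty_iff_ne_empty]
  rintro rfl
  simpa using hp.2

theorem shannonEntropy_nonneg {p : S → ℝ} (hp : IsDistribution E p) : 0 ≤ shannonEntropy E p :=
  sum_nonneg fun e he => negMulLog_nonneg (hp.1 e he) (hp.le_one he)

theorem mul_log_div_le {p q : ℝ} (hp : 0 ≤ p) (hp1 : p ≤ 1) (hq : 0 < q) :
    p * log (p / q) ≤ -(p * log q) := by
  rcases hp.eq_or_lt with h0 | h0
  · simp [← h0]
  · rw [log_div h0.ne' hq.ne']
    have := mul_nonpos_of_nonneg_of_nonpos hp (log_nonpos hp hp1)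
    linarith

theorem klDivergence_le_neg_sum_mul_log {p q : S → ℝ} (hp : IsDistribution E p)
    (hq : ∀ e ∈ E, 0 < q e) : klDivergence E p q ≤ -∑ e ∈ E, p e * log (q e) := by
  rw [← sum_neg_distrib]
  exact sum_le_sum fun e he => mul_log_div_le (hp.1 e he) (hp.le_one he) (hq e he)

/-- With `δ = α / |E|` this gives the bound `m D²` that the EWOO interval is built for. -/
theorem klDivergence_le_log {p q : S → ℝ} (hp : IsDistribution E p) {δ : ℝ} (hδ : 0 < δ)
    (hq : ∀ e ∈ E, δ ≤ q e) : klDivergence E p q ≤ log (1 / δ) := by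
  refine (klDivergence_le_neg_sum_mul_log hp fun e he => hδ.trans_le (hq e he)).trans ?_
  rw [one_div, log_inv, neg_le_neg_iff]
  calc log δ = ∑ e ∈ E, p e * log δ := by rw [← sum_mul, hp.2, one_mul]
    _ ≤ _ := sum_le_sum fun e he =>
      mul_le_mul_of_nonneg_left (log_le_log hδ (hq e he)) (hp.1 e he)

/-- Follow-the-leader for the Kullback–Leibler divergence: predicting each distribution by the running
mean of the earlier ones. -/
theorem sum_klDivergence_runningMean_le {z q : ℕ → S → ℝ} {δ : ℝ} (hδ : 0 < δ) (T : ℕ)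
    (hz : ∀ t < T, IsDistribution E (z t)) (hq : ∀ t ≤ T, IsDistribution E (q t))
    (hlow : ∀ t ≤ T, ∀ e ∈ E, δ ≤ q t e)
    (hrec : ∀ t < T, ∀ e ∈ E, (t + 1) * q (t + 1) e = t * q t e + z t e) :
    ∑ t ∈ range T, klDivergence E (z t) (q t) ≤
      T * shannonEntropy E (q T) + 1 / δ * ∑ t ∈ range T, ((t : ℝ) + 1)⁻¹ := by
  induction T with
  | zero => simp
  | succ n ih =>
    have ih := ih (fun t ht => hz t (by omega)) (fun t ht => hq t (by omega))
      (fun t ht => hlow t (by omega)) (fun t ht => hrec t (by omega))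
    have hqn := fun e he => hδ.trans_le (hlow n (by omega) e he)
    have hqn' := fun e he => hδ.trans_le (hlow (n + 1) le_rfl e he)
    have hzn := hz n (by omega)
    have hn1 : (0 : ℝ) < n + 1 := by positivity
    have hkl := klDivergence_le_neg_sum_mul_log hzn hqn
    -- Be-the-leader: coding the past mean `q n` with the next one only raises its cost, so the
    -- entropies can be chained.
    have hgibbs : shannonEntropy E (q n) ≤ -∑ e ∈ E, q n e * log (q (n + 1) e) := by
      have h := klDivergence_nonneg (hq n (by omega)) hqn' (hq (n + 1) le_rfl).2
      have heq : klDivergence E (q n) (q (n + 1)) =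
          -shannonEntropy E (q n) - ∑ e ∈ E, q n e * log (q (n + 1) e) := by
        rw [klDivergence, shannonEntropy, ← sum_neg_distrib, ← sum_sub_distrib]
        refine sum_congr rfl fun e he => ?_
        rw [log_div (hqn e he).ne' (hqn' e he).ne', negMulLog]
        ring
      linarith
    -- Stability: the mean moves by a relative amount `(z / q - 1) / (n + 1)`, and `q ≥ δ` bounds it
    -- by `1 / (δ (n + 1))`.
    have hstep : ∑ e ∈ E, z n e * log (q (n + 1) e) - ∑ e ∈ E, z n e * log (q n e) ≤
        1 / δ * ((n : ℝ) + 1)⁻¹ := by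
      rw [← sum_sub_distrib]
      calc _ ≤ ∑ e ∈ E, z n e * (1 / δ * ((n : ℝ) + 1)⁻¹) := by
            refine sum_le_sum fun e he => ?_
            rw [← mul_sub, ← log_div (hqn' e he).ne' (hqn e he).ne']
            refine mul_le_mul_of_nonneg_left ?_ (hzn.1 e he)
            refine (log_le_sub_one_of_pos (div_pos (hqn' e he) (hqn e he))).trans ?_
            have h1 : z n e / q n e ≤ 1 / δ :=
              div_le_div₀ zero_le_one (hzn.le_one he) hδ (hlow n (by omega) e he)
            have h2 : q (n + 1) e / q n e - 1 = (z n e / q n e - 1) * ((n : ℝ) + 1)⁻¹ := by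
              have h3 : q (n + 1) e = (n * q n e + z n e) / (n + 1) := by
                rw [← hrec n (by omega) e he, mul_div_cancel_left₀ _ hn1.ne']
              have := (hqn e he).ne'
              rw [h3]
              field_simp
              ring
            rw [h2]
            exact mul_le_mul_of_nonneg_right (by linarith) (by positivity)
        _ = _ := by rw [← sum_mul, hzn.2, one_mul]
    have hent : ((n : ℝ) + 1) * shannonEntropy E (q (n + 1)) =
        -(n * ∑ e ∈ E, q n e * log (q (n + 1) e)) - ∑ e ∈ E, z n e * log (q (n + 1) e) := by
      rw [shannonEntropy, mul_sum, mul_sum, ← sum_neg_distrib, ← sum_sub_distrib]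
      refine sum_congr rfl fun e he => ?_
      have := hrec n (by omega) e he
      rw [negMulLog, neg_mul, mul_neg, ← mul_assoc, this]
      ring
    have hmul := mul_le_mul_of_nonneg_left hgibbs (Nat.cast_nonneg (α := ℝ) n)
    rw [sum_range_succ, sum_range_succ, mul_add]
    push_cast
    rw [hent]
    linarith

theorem negMulLog_add_le {a b : ℝ} (ha : 0 ≤ a) (hb : 0 ≤ b) :
    negMulLog (a + b) ≤ negMulLog a + negMulLog b := by
  have key : ∀ {x y : ℝ}, 0 ≤ x → 0 ≤ y → x * log x ≤ x * log (x + y) := by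
    intro x y hx hy
    rcases hx.eq_or_lt with h0 | h0
    · simp [← h0]
    · exact mul_le_mul_of_nonneg_left (log_le_log h0 (by linarith)) hx
  have h1 := key ha hb
  have h2 := key hb ha
  rw [add_comm b a] at h2
  simp only [negMulLog]
  linarith

/-- Subadditivity of `negMulLog` separates the mixture: scaling `p` by `1 - α` adds at most `α`, and
the uniform part contributes `α log (|E| / α)`. -/
theorem shannonEntropy_smoothed_le {p : S → ℝ} (hp : IsDistribution E p) {α : ℝ} (hα : 0 < α)
    (hα1 : α ≤ 1) :
    shannonEntropy E (smoothed E α p) ≤ shannonEntropy E p + α + α * log (#E / α) := by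
  have hN : (0 : ℝ) < #E := by exact_mod_cast hp.nonempty.card_pos
  have h1 : shannonEntropy E (smoothed E α p) ≤
      ∑ e ∈ E, (negMulLog ((1 - α) * p e) + negMulLog (α / #E)) :=
    sum_le_sum fun e he =>
      negMulLog_add_le (mul_nonneg (by linarith) (hp.1 e he)) (by positivity)
  have h2 : ∑ e ∈ E, negMulLog (α / #E) = α * log (#E / α) := by
    rw [sum_const, nsmul_eq_mul, negMulLog, ← inv_div (#E : ℝ) α, log_inv]
    field_simp
  have h3 : ∑ e ∈ E, negMulLog ((1 - α) * p e) = negMulLog (1 - α) + (1 - α) * shannonEntropy E p := by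
    simp_rw [negMulLog_mul]
    rw [sum_add_distrib, ← sum_mul, hp.2, one_mul, ← mul_sum, shannonEntropy]
  have h4 : negMulLog (1 - α) ≤ α := by
    rcases hα1.eq_or_lt with rfl | h
    · simp
    · have h5 := log_le_sub_one_of_pos (inv_pos.2 (sub_pos.2 h))
      have h6 := mul_le_mul_of_nonneg_left h5 (sub_pos.2 h).le
      rw [mul_sub, mul_inv_cancel₀ (sub_pos.2 h).ne', log_inv] at h6
      rw [negMulLog]
      linarith
  rw [sum_add_distrib, h2, h3] at h1
  have h7 := mul_nonneg hα.le (shannonEntropy_nonneg hp)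
  linarith

theorem isDistribution_smoothed {p : S → ℝ} (hp : IsDistribution E p) {α : ℝ} (hα : 0 ≤ α)
    (hα1 : α ≤ 1) : IsDistribution E (smoothed E α p) := by
  have hN : (#E : ℝ) ≠ 0 := by exact_mod_cast hp.nonempty.card_pos.ne'
  refine ⟨fun e he => add_nonneg (mul_nonneg (by linarith) (hp.1 e he)) (by positivity), ?_⟩
  simp only [smoothed]
  rw [sum_add_distrib, ← mul_sum, hp.2, sum_const, nsmul_eq_mul, mul_div_cancel₀ _ hN]
  ring

theorem le_smoothed {p : S → ℝ} (hp : IsDistribution E p) {α : ℝ} (hα1 : α ≤ 1) {e : S}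
    (he : e ∈ E) : α / #E ≤ smoothed E α p e :=
  le_add_of_nonneg_left (mul_nonneg (by linarith) (hp.1 e he))

theorem isDistribution_averageDist {y : ℕ → S → ℝ} {t : ℕ} (ht : t ≠ 0)
    (hy : ∀ s < t, IsDistribution E (y s)) : IsDistribution E (averageDist y t) := by
  refine ⟨fun e he => div_nonneg (sum_nonneg fun s hs => (hy s (mem_range.1 hs)).1 e he)
    (Nat.cast_nonneg _), ?_⟩
  simp only [averageDist]
  rw [← sum_div, sum_comm, sum_congr rfl fun s hs => (hy s (mem_range.1 hs)).2]
  simp [ht]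

theorem offset_pos {m T : ℕ} (hm : 1 ≤ m) (hT : 1 ≤ T) : 0 < offset m T := by
  have : 0 < m := hm
  have : 0 < T := hT
  unfold offset
  positivity

theorem offset_le_one {m T : ℕ} (hm : 1 ≤ m) (hT : 1 ≤ T) : offset m T ≤ 1 := by
  have h : (1 : ℝ) ≤ m * T := by exact_mod_cast Nat.mul_le_mul hm hT
  exact div_le_one_of_le₀ (one_le_sqrt.2 h) (sqrt_nonneg _)

section MetaInit

variable {m T : ℕ} {y : ℕ → S → ℝ}

theorem isDistribution_metaInit (hE : E.Nonempty) (hm : 1 ≤ m) (hT : 1 ≤ T)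
    (hy : ∀ t < T, IsDistribution E (y t)) {t : ℕ} (ht : t ≤ T) :
    IsDistribution E (metaInit E m T y t) := by
  have hN : (#E : ℝ) ≠ 0 := by exact_mod_cast hE.card_pos.ne'
  rw [metaInit]
  split_ifs with h
  · exact ⟨fun e _ => by positivity, by simp [hN]⟩
  · exact isDistribution_averageDist h fun s hs => isDistribution_smoothed (hy s (by omega))
      (offset_pos hm hT).le (offset_le_one hm hT)

theorem le_metaInit (hm : 1 ≤ m) (hT : 1 ≤ T)
    (hy : ∀ t < T, IsDistribution E (y t)) {t : ℕ} (ht : t ≤ T) {e : S} (he : e ∈ E) :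
    offset m T / #E ≤ metaInit E m T y t e := by
  rw [metaInit]
  split_ifs with h
  · exact div_le_div_of_nonneg_right (offset_le_one hm hT) (Nat.cast_nonneg _)
  · have ht : (0 : ℝ) < t := by exact_mod_cast Nat.pos_of_ne_zero h
    rw [averageDist, le_div_iff₀ ht, mul_comm]
    have := card_nsmul_le_sum (range t) (fun s => smoothed E (offset m T) (y s) e)
      (offset m T / #E) fun s hs =>
        le_smoothed (hy s (by have := mem_range.1 hs; omega)) (offset_le_one hm hT) he
    simpa using this

/-- The uniform start has weight zero at `t = 0`, so the running-mean recursion also covers the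
first task. -/
theorem metaInit_succ (t : ℕ) (e : S) :
    ((t : ℝ) + 1) * metaInit E m T y (t + 1) e =
      t * metaInit E m T y t e + smoothed E (offset m T) (y t) e := by
  have h1 : ((t : ℝ) + 1) ≠ 0 := by positivity
  simp only [metaInit, averageDist, Nat.succ_ne_zero, if_false]
  push_cast
  rw [mul_div_cancel₀ _ h1, sum_range_succ]
  rcases eq_or_ne t 0 with rfl | h
  · simp
  · have h2 : (t : ℝ) ≠ 0 := by exact_mod_cast h
    simp only [h, if_false, averageDist]
    rw [mul_div_cancel₀ _ h2]

/-- Smoothing is affine and commutes with averaging. The initialization that would follow the last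
task is therefore the smoothed `ȳ`. -/
theorem metaInit_eq_smoothed (hT : T ≠ 0) :
    metaInit E m T y T = smoothed E (offset m T) (averageDist y T) := by
  have h2 : (T : ℝ) ≠ 0 := by exact_mod_cast hT
  ext e
  simp only [metaInit, hT, if_false, averageDist, smoothed]
  rw [sum_add_distrib, ← mul_sum]
  simp
  field_simp

theorem card_div_offset (E : Finset S) (m T : ℕ) : (#E : ℝ) / offset m T = #E * √(m * T) := by
  rw [offset, div_div_eq_mul_div, div_one]

/-- The total divergence of the smoothed optima from the initializations is governed by the entropy of
the mean optimum. -/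
theorem sum_klDivergence_metaInit_le (hE : E.Nonempty) (hm : 1 ≤ m) (hT : 1 ≤ T)
    (hy : ∀ t < T, IsDistribution E (y t)) :
    ∑ t ∈ range T, klDivergence E (smoothed E (offset m T) (y t)) (metaInit E m T y t) ≤
      T * shannonEntropy E (averageDist y T) + 8 * #E * √(m * T) * (log T + 1) := by
  have hα := offset_pos hm hT
  have hα1 := offset_le_one hm hT
  have hN1 : (1 : ℝ) ≤ #E := by exact_mod_cast hE.card_pos
  have hm1 : (1 : ℝ) ≤ m := by exact_mod_cast hm
  have hT1 : (1 : ℝ) ≤ T := by exact_mod_cast hT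
  have hL : 0 ≤ log (T : ℝ) := log_nonneg hT1
  have hδ : 0 < offset m T / #E := by positivity
  have h := sum_klDivergence_runningMean_le hδ T
    (fun t ht => isDistribution_smoothed (hy t ht) hα.le hα1)
    (fun t ht => isDistribution_metaInit hE hm hT hy ht)
    (fun t ht e he => le_metaInit hm hT hy ht he) (fun t _ e _ => metaInit_succ t e)
  have hH : ∑ t ∈ range T, ((t : ℝ) + 1)⁻¹ ≤ 1 + log T := by
    have := harmonic_le_one_add_log T
    rw [harmonic] at this
    push_cast at this
    exact this
  have hs : 0 < √((m : ℝ) * T) := by positivity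
  have hs2 : √((m : ℝ) * T) * √((m : ℝ) * T) = m * T := mul_self_sqrt (by positivity)
  rw [metaInit_eq_smoothed (by omega), one_div_div, card_div_offset] at h
  have hent := shannonEntropy_smoothed_le
    (isDistribution_averageDist (by omega : T ≠ 0) hy) hα hα1
  rw [card_div_offset] at hent
  have hTα : T * offset m T = √(m * T) / m := by
    rw [offset, mul_one_div, div_eq_div_iff hs.ne' (by positivity), hs2, mul_comm]
  have hlog : log (#E * √(m * T)) ≤ #E - 1 + (m + log T) / 2 := by
    rw [log_mul (by positivity) hs.ne', log_sqrt (by positivity),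
      log_mul (by positivity) (by positivity)]
    have h1 := log_le_sub_one_of_pos (by positivity : (0 : ℝ) < #E)
    have h2 := log_le_sub_one_of_pos (by positivity : (0 : ℝ) < m)
    linarith
  -- The entropy added by smoothing accounts for 7 of the constant 8; the harmonic sum, with `1 / δ
  -- = |E| √(m T)`, takes the remaining 1.
  have hextra : T * (offset m T + offset m T * log (#E * √(m * T))) ≤
      7 * #E * √(m * T) * (log T + 1) := by
    have h1 : T * (offset m T + offset m T * log (#E * √(m * T))) =
        √(m * T) * ((1 + log (#E * √(m * T))) / m) := by
      rw [← mul_one_add, ← mul_assoc, hTα]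
      ring
    have h2 : (1 + log (#E * √(m * T))) / m ≤ 7 * #E * (log T + 1) := by
      rw [div_le_iff₀ (by positivity)]
      have h3 : 1 ≤ (#E : ℝ) * m := one_le_mul_of_one_le_of_one_le hN1 hm1
      have h4 : (#E : ℝ) ≤ #E * m := le_mul_of_one_le_right (by positivity) hm1
      have h5 : (m : ℝ) ≤ #E * m := le_mul_of_one_le_left (by positivity) hN1
      have h6 : log (T : ℝ) ≤ #E * m * log T := le_mul_of_one_le_left hL h3
      nlinarith
    rw [h1]
    calc _ ≤ √(m * T) * (7 * #E * (log T + 1)) := mul_le_mul_of_nonneg_left h2 hs.le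
      _ = _ := by ring
  have h7 := mul_le_mul_of_nonneg_left hent (by positivity : (0 : ℝ) ≤ T)
  have h8 := mul_le_mul_of_nonneg_left hH (by positivity : 0 ≤ (#E : ℝ) * √(m * T))
  linarith

end MetaInit

end Entropy

/-! ### Learning rates: comparison with a fixed rate and explicit tuning -/

section Rates

/-- The exponentially weighted learning rates compete with every fixed learning rate `x`. -/
theorem sum_rate_regret_le {m D ρ β : ℝ} (hm : 0 < m) (hD : 0 < D) (hρ : 0 < ρ) (hρ1 : ρ ≤ 1)
    (hβ : β = 2 / (m * D) * ρ ^ 2) {T : ℕ} (hT : 1 ≤ T) {K : ℕ → ℝ}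
    (hK : ∀ t < T, 0 ≤ K t ∧ K t ≤ m * D ^ 2) {U : ℕ → ℝ → ℝ}
    (hU : ∀ t x, U t x = m * (x + (K t / m + ρ ^ 2 * D ^ 2) / x)) {η : ℕ → ℝ}
    (hη : ∀ t < T, η t =
      (∫ x in (ρ * D)..√(D ^ 2 + ρ ^ 2 * D ^ 2), x * exp (-β * ∑ s ∈ range t, U s x)) /
        ∫ x in (ρ * D)..√(D ^ 2 + ρ ^ 2 * D ^ 2), exp (-β * ∑ s ∈ range t, U s x))
    {x : ℝ} (hx : 0 < x) :
    (∀ t < T, 0 < η t) ∧ ∑ t ∈ range T, (K t / η t + m * η t / 2) ≤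
      T * (m * D * min (D * ρ ^ 2 / x) ρ + x * m) + (∑ t ∈ range T, K t) / x
        + (1 + log (T + 1)) * (m * D / (2 * ρ ^ 2)) := by
  have hT' : (0 : ℝ) < T := by exact_mod_cast hT
  have hr : 0 < ρ * D := mul_pos hρ hD
  have hab : ρ * D < √(D ^ 2 + ρ ^ 2 * D ^ 2) := by
    rw [lt_sqrt hr.le, mul_pow]
    linarith [pow_pos hD 2]
  have hβ0 : 0 < β := by
    rw [hβ]
    positivity
  have hcont : ∀ t, ContinuousOn (U t) (Set.Icc (ρ * D) √(D ^ 2 + ρ ^ 2 * D ^ 2)) := by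
    intro t
    rw [funext (hU t)]
    exact continuousOn_const.mul (continuousOn_id.add (continuousOn_const.div continuousOn_id
      fun y hy => (hr.trans_le hy.1).ne'))
  have hmem : ∀ t < T, η t ∈ Set.Icc (ρ * D) √(D ^ 2 + ρ ^ 2 * D ^ 2) := by
    intro t ht
    rw [hη t ht]
    exact weighted_mean_mem_Icc hab
      (continuousOn_const.mul (continuousOn_finsetSum _ fun s _ => hcont s)).rexp
      fun _ _ => exp_pos _
  have hη0 : ∀ t < T, 0 < η t := fun t ht => hr.trans_le (hmem t ht).1
  refine ⟨hη0, ?_⟩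
  have hsuper : ∀ t < T, ∀ y ∈ Set.Icc (ρ * D) √(D ^ 2 + ρ ^ 2 * D ^ 2),
      ∃ c, ∀ x ∈ Set.Icc (ρ * D) √(D ^ 2 + ρ ^ 2 * D ^ 2),
        exp (-β * U t x) ≤ exp (-β * U t y) + c * (x - y) := by
    intro t ht
    simp only [hU]
    refine exists_supergradient_exp hr (fun y hy => ?_) hβ0.le
    have hy0 : 0 < y := hr.trans_le hy.1
    set c := K t / m + ρ ^ 2 * D ^ 2 with hc
    have hD2 : 0 < D ^ 2 := pow_pos hD 2
    have hK0 : 0 ≤ K t / m := div_nonneg (hK t ht).1 hm.le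
    have hK1 : K t / m ≤ D ^ 2 := by
      rw [div_le_iff₀' hm]
      exact (hK t ht).2
    have hy2 : y ^ 2 ≤ D ^ 2 + ρ ^ 2 * D ^ 2 := (le_sqrt' hy0).1 hy.2
    -- Measuring `y` in units of `D` and `c` in units of `D²` turns the condition `β U'² ≤ U''` into
    -- `mul_sq_sub_le` with `r = ρ`.
    have h := mul_sq_sub_le (s := y / D) (c := c / D ^ 2) hρ hρ1 ((le_div_iff₀ hD).2 hy.1)
      (by rw [div_pow, div_le_iff₀ hD2]; linarith) (by rw [le_div_iff₀ hD2]; linarith)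
      (by rw [div_le_iff₀ hD2]; linarith)
    have h1 := mul_le_mul_of_nonneg_left h (by positivity : 0 ≤ 2 * m * D ^ 3 / y ^ 4)
    have h2 : β * m ^ 2 * (1 - c / y ^ 2) ^ 2 =
        2 * m * D ^ 3 / y ^ 4 * (ρ ^ 2 * ((y / D) ^ 2 - c / D ^ 2) ^ 2) := by
      rw [hβ]
      field_simp
    have h3 : m * (2 * c / y ^ 3) = 2 * m * D ^ 3 / y ^ 4 * (c / D ^ 2 * (y / D)) := by
      field_simp
    rw [h2, h3]
    exact h1
  -- `V` is the mean of `K t / m`, and `w = √(V + ρ² D²)` minimizes the summed surrogates. Since `0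
  -- ≤ V ≤ D²`, it lies in the search interval, although the given `x` need not.
  set V := (∑ t ∈ range T, K t) / (m * T) with hV
  have hKsum : ∑ t ∈ range T, K t = m * T * V := by
    rw [hV]
    field_simp
  have hV0 : 0 ≤ V :=
    div_nonneg (sum_nonneg fun t ht => (hK t (mem_range.1 ht)).1) (by positivity)
  have hV1 : V ≤ D ^ 2 := by
    rw [hV, div_le_iff₀ (by positivity)]
    refine (sum_le_sum fun t ht => (hK t (mem_range.1 ht)).2).trans_eq ?_
    simp
    ring
  have hpos : 0 < V + ρ ^ 2 * D ^ 2 := by positivity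
  set w := √(V + ρ ^ 2 * D ^ 2) with hw
  have hw0 : 0 < w := sqrt_pos.2 hpos
  have hww : w * w = V + ρ ^ 2 * D ^ 2 := mul_self_sqrt hpos.le
  have hwmem : w ∈ Set.Icc (ρ * D) √(D ^ 2 + ρ ^ 2 * D ^ 2) := by
    refine ⟨?_, sqrt_le_sqrt (by linarith)⟩
    rw [hw, le_sqrt' hr, mul_pow]
    linarith
  have hreg := sum_ewoo_le hab hβ0 T U (fun t _ => hcont t) hsuper η hη hwmem
  have hUw : ∑ t ∈ range T, U t w = T * (m * (2 * w)) := by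
    have h1 : ∀ t, U t w = m * (w + ρ ^ 2 * D ^ 2 / w) + K t / w := by
      intro t
      rw [hU]
      field_simp
      ring
    simp only [h1]
    rw [sum_add_distrib, ← sum_div, hKsum]
    simp only [sum_const, card_range, nsmul_eq_mul]
    field_simp
    linarith
  have hrβ : (1 + log ((T : ℝ) + 1)) / β = (1 + log (T + 1)) * (m * D / (2 * ρ ^ 2)) := by
    rw [hβ]
    field_simp
  -- The surrogate charges `m η` where the regret needs `m η / 2`, and it also carries the
  -- regularizer. By AM-GM this slack is at least `√2 m ρ D`, here rounded down to `7 / 5`.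
  have hper : ∑ t ∈ range T, (K t / η t + m * η t / 2) ≤
      ∑ t ∈ range T, (U t (η t) - m * (7 / 5 * (ρ * D))) := by
    refine sum_le_sum fun t ht => ?_
    have h0 := hη0 t (mem_range.1 ht)
    have h1 : U t (η t) = K t / η t + m * (η t + (ρ * D) ^ 2 / η t) := by
      rw [hU]
      field_simp
      ring
    have h2 : 7 / 5 * (ρ * D) ≤ η t / 2 + (ρ * D) ^ 2 / η t := by
      rw [← sub_le_iff_le_add', le_div_iff₀ h0]
      nlinarith [sq_nonneg (η t - 7 / 5 * (ρ * D)), mul_pos hr hr]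
    have h3 := mul_le_mul_of_nonneg_left h2 hm.le
    rw [h1]
    linarith
  rw [sum_sub_distrib, sum_const, card_range, nsmul_eq_mul] at hper
  -- In the first branch AM-GM is applied to `V + ρ² D²`, in the second to `V` alone, with `w ≤ √V +
  -- ρ D`. There the slack `7 / 5` reduces the excess `2 ρ D` below `ρ D`.
  have hfix : 2 * w - 7 / 5 * (ρ * D) ≤ D * min (D * ρ ^ 2 / x) ρ + x + V / x := by
    rcases min_choice (D * ρ ^ 2 / x) ρ with h | h
    · have h1 : 2 * w ≤ x + (V + ρ ^ 2 * D ^ 2) / x := by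
        rw [← sub_le_iff_le_add', le_div_iff₀ hx, ← hww]
        nlinarith [sq_nonneg (x - w)]
      rw [h]
      have h2 : D * (D * ρ ^ 2 / x) + x + V / x = x + (V + ρ ^ 2 * D ^ 2) / x := by ring
      rw [h2]
      linarith
    · have hs : √V * √V = V := mul_self_sqrt hV0
      have h1 : 2 * √V ≤ x + V / x := by
        rw [← sub_le_iff_le_add', le_div_iff₀ hx]
        nlinarith [sq_nonneg (x - √V)]
      have h2 : w ≤ √V + ρ * D := by
        rw [hw, sqrt_le_iff]
        refine ⟨by positivity, ?_⟩
        nlinarith [mul_nonneg (sqrt_nonneg V) hr.le]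
      rw [h]
      linarith
  have hfinal := mul_le_mul_of_nonneg_left hfix (by positivity : 0 ≤ T * m)
  have hVx : (∑ t ∈ range T, K t) / x = T * m * (V / x) := by
    rw [hKsum]
    ring
  rw [hVx, ← hrβ]
  linarith

/-- The explicit bound obtained from the learning rate `√(H / m) + T ^ (-1/4)`. -/
theorem explicit_regret_bound {R H : ℝ} {m T N : ℕ} (hm : 1 ≤ m) (hT : 1 ≤ T) (hN : 1 ≤ N)
    (hH : 0 ≤ H)
    (h : ∀ η : ℝ, 0 < η → R ≤ 4 * √((m : ℝ) / T)
        + √(m * log (N * √(m * T))) *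
            (min (√(log (N * √(m * T))) / (η * √(T * m))) (1 / (T : ℝ) ^ (1 / 4 : ℝ))
              + (1 + log ((T : ℝ) + 1)) / (2 * √T))
        + (η * m + H / η + 8 * N * √m * (log T + 1) / (η * √T))) :
    R ≤ 2 * √(H * m) + 16 * m * N * (1 + log T) / (T : ℝ) ^ (1 / 4 : ℝ) := by
  have hm1 : (1 : ℝ) ≤ m := by exact_mod_cast hm
  have hT1 : (1 : ℝ) ≤ T := by exact_mod_cast hT
  have hN1 : (1 : ℝ) ≤ N := by exact_mod_cast hN
  have hm0 : (0 : ℝ) < m := by linarith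
  have hT0 : (0 : ℝ) < T := by linarith
  have hN0 : (0 : ℝ) < N := by linarith
  set L := log (T : ℝ) with hL
  have hL0 : 0 ≤ L := log_nonneg hT1
  set q := (T : ℝ) ^ (1 / 4 : ℝ) with hq
  have hq1 : 1 ≤ q := one_le_rpow hT1 (by norm_num)
  have hq0 : 0 < q := by linarith
  have hsT : √(T : ℝ) = q ^ 2 := by
    rw [sqrt_eq_rpow, hq, ← rpow_natCast, ← rpow_mul hT0.le]
    norm_num
  have hmN : 1 ≤ (m : ℝ) * N := one_le_mul_of_one_le_of_one_le hm1 hN1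
  have hmN1 : (N : ℝ) ≤ m * N := le_mul_of_one_le_left hN0.le hm1
  have hmN2 : (m : ℝ) ≤ m * N := le_mul_of_one_le_right hm0.le hN1
  have hsm : √(m : ℝ) ≤ m := sqrt_le_iff.2 ⟨hm0.le, by nlinarith⟩
  set P := log (N * √((m : ℝ) * T)) with hP
  have hPle : P ≤ N - 1 + (m - 1 + L) / 2 := by
    rw [hP, log_mul (by positivity) (by positivity), log_sqrt (by positivity),
      log_mul (by positivity) (by positivity)]
    have h1 := log_le_sub_one_of_pos hN0
    have h2 := log_le_sub_one_of_pos hm0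
    linarith
  have hLq : L ≤ 2 * (q ^ 2 - 1) := by
    have h1 := log_le_sub_one_of_pos (pow_pos hq0 2)
    rw [← hsT, log_sqrt hT0.le] at h1
    rw [← hsT]
    linarith
  have hNm : (N : ℝ) - 1 + (m - 1) / 2 ≤ m * N - 1 := by nlinarith
  set A := √(m * P) with hA
  have hA0 : 0 ≤ A := sqrt_nonneg _
  have hA1 : A ≤ m * N * (1 + L) := by
    refine sqrt_le_iff.2 ⟨by positivity, ?_⟩
    have h1 : P ≤ m * N * (1 + L) := by nlinarith
    have h2 : (m : ℝ) ≤ m * N * (1 + L) := by nlinarith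
    have h3 : (m : ℝ) * P ≤ m * (m * N * (1 + L)) := mul_le_mul_of_nonneg_left h1 hm0.le
    have h4 : (m : ℝ) * (m * N * (1 + L)) ≤ m * N * (1 + L) * (m * N * (1 + L)) :=
      mul_le_mul_of_nonneg_right h2 (by positivity)
    linarith
  -- A log-free bound, for the term that already contains `log (T + 1)`; the extra `q` is absorbed
  -- by `√T = q ^ 2`.
  have hA2 : A ≤ m * N * q := by
    refine sqrt_le_iff.2 ⟨by positivity, ?_⟩
    have h0 : q ^ 2 - 1 ≤ m * N * (q ^ 2 - 1) := by
      refine le_mul_of_one_le_left ?_ hmN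
      nlinarith
    have h1 : P ≤ m * N * q ^ 2 := by linarith
    have h3 : (m : ℝ) * P ≤ m * (m * N * q ^ 2) := mul_le_mul_of_nonneg_left h1 hm0.le
    have h4 : (m : ℝ) * (m * N * q ^ 2) ≤ m * N * (m * N * q ^ 2) :=
      mul_le_mul_of_nonneg_right hmN2 (by positivity)
    linarith
  have hlogT : log ((T : ℝ) + 1) ≤ 1 + L := by
    have h1 : log ((T : ℝ) + 1) ≤ log (2 * T) := log_le_log (by positivity) (by linarith)
    rw [log_mul two_ne_zero hT0.ne'] at h1
    have h2 := log_le_sub_one_of_pos (zero_lt_two (α := ℝ))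
    linarith
  set η := √H / √m + 1 / q with hη
  have hη1 : 1 / q ≤ η := le_add_of_nonneg_left (by positivity)
  have hη0 : 0 < η := lt_of_lt_of_le (by positivity) hη1
  have hsm0 : 0 < √(m : ℝ) := sqrt_pos.2 hm0
  have hsmm : √(m : ℝ) * √m = m := mul_self_sqrt hm0.le
  have hHH : √H * √H = H := mul_self_sqrt hH
  have hHm : √(H * m) = √H * √m := sqrt_mul hH _
  -- All vanishing terms are multiples of `B`: 4 and 1 from `t1` and `t2`, then 1, 1 and 8 from
  -- `t3`, `t4` and `t6`, in total 15.
  set B := m * N * (1 + L) / q with hB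
  have hB1 : (m : ℝ) / q ≤ B := by
    refine div_le_div_of_nonneg_right ?_ hq0.le
    nlinarith
  have t1 : √((m : ℝ) / T) ≤ B := by
    rw [sqrt_div hm0.le, hsT]
    refine le_trans ?_ hB1
    exact div_le_div₀ hm0.le hsm hq0 (by nlinarith)
  have t2 : A * min (√P / (η * √(T * m))) (1 / q) ≤ B := by
    calc _ ≤ A * (1 / q) := mul_le_mul_of_nonneg_left (min_le_right _ _) hA0
      _ = A / q := mul_one_div _ _
      _ ≤ B := div_le_div_of_nonneg_right hA1 hq0.le
  have t3 : A * ((1 + log ((T : ℝ) + 1)) / (2 * √T)) ≤ B := by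
    rw [hsT]
    calc _ ≤ m * N * q * ((1 + L) / q ^ 2) := by
          refine mul_le_mul hA2 ?_ ?_ (by positivity)
          · rw [div_le_div_iff₀ (by positivity) (by positivity)]
            have : 1 + log ((T : ℝ) + 1) ≤ (1 + L) * 2 := by linarith
            calc _ ≤ (1 + L) * 2 * q ^ 2 := mul_le_mul_of_nonneg_right this (by positivity)
              _ = _ := by ring
          · have : 0 ≤ log ((T : ℝ) + 1) := log_nonneg (by linarith)
            positivity
      _ = B := by
          rw [hB]
          field_simp
  have t4 : η * m ≤ √(H * m) + B := by
    have : η * m = √H * √m + m / q := by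
      rw [hη, add_mul, div_mul_eq_mul_div, mul_div_assoc, div_sqrt]
      ring
    rw [this, hHm]
    linarith
  have t5 : H / η ≤ √(H * m) := by
    rw [div_le_iff₀ hη0, hHm, hη, mul_add]
    have h1 : √H * √m * (√H / √m) = H := by
      field_simp
      linarith
    have h2 : 0 ≤ √H * √m * (1 / q) := by positivity
    linarith
  have t6 : 8 * N * √m * (L + 1) / (η * √T) ≤ 8 * B := by
    have h1 : q ≤ η * √T := by
      rw [hsT]
      calc q = 1 / q * q ^ 2 := by field_simp
        _ ≤ η * q ^ 2 := mul_le_mul_of_nonneg_right hη1 (by positivity)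
    calc _ ≤ 8 * N * m * (L + 1) / q := by
          refine div_le_div₀ (by positivity) ?_ hq0 h1
          gcongr
      _ = 8 * B := by
          rw [hB]
          ring
  have hfin := h η hη0
  rw [mul_add] at hfin
  have hBnn : 0 ≤ B := by positivity
  have : 16 * m * N * (1 + L) / q = 16 * B := by
    rw [hB]
    ring
  rw [this]
  linarith

end Rates

/-! ### From random plays to the averaged regret -/

section Regret

variable {S : Type*} {E : Finset S}

/-- The masses on `E` exhaust the probability, so `g ∘ X` is almost surely a finite combination of
indicators, without regularity of `g`. As regret is a sum over rounds, only the marginal laws of the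
plays matter. -/
theorem integral_comp_of_isDrawnFrom [MeasurableSpace S] [MeasurableSingletonClass S]
    {Ω : Type*} [MeasurableSpace Ω] {μ : Measure Ω} [IsProbabilityMeasure μ] {X : Ω → S} {p : S → ℝ}
    (hX : IsDrawnFrom μ X E p) (hp : ∑ e ∈ E, p e = 1) (g : S → ℝ) :
    Integrable (fun ω => g (X ω)) μ ∧ ∫ ω, g (X ω) ∂μ = ∑ e ∈ E, p e * g e := by
  have hmeas : ∀ e, MeasurableSet {ω | X ω = e} := fun e => hX.1 (measurableSet_singleton e)
  have hae : ∀ᵐ ω ∂μ, X ω ∈ E := by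
    have hset : {ω | X ω ∈ E} = ⋃ e ∈ E, {ω | X ω = e} := by
      ext ω
      simp
    have hm : MeasurableSet {ω | X ω ∈ E} := hset ▸ E.measurableSet_biUnion fun e _ => hmeas e
    have h1 : μ.real {ω | X ω ∈ E} = 1 := by
      rw [hset, measureReal_biUnion_finset _ fun e _ => hmeas e, sum_congr rfl hX.2, hp]
      intro a _ b _ hab
      exact Set.disjoint_left.2 fun ω ha hb => hab (Eq.trans (Eq.symm ha) hb)
    have h2 : μ {ω | X ω ∈ E} = 1 := by
      rw [← ofReal_measureReal, h1, ENNReal.ofReal_one]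
    exact (mem_ae_iff_prob_eq_one hm).2 h2
  have heq : (fun ω => ∑ e ∈ E, Set.indicator {ω | X ω = e} (fun _ => g e) ω) =ᵐ[μ]
      fun ω => g (X ω) := by
    filter_upwards [hae] with ω hω
    rw [sum_eq_single_of_mem (X ω) hω]
    · exact Set.indicator_of_mem (s := {ω' | X ω' = X ω}) rfl _
    · exact fun e _ he => Set.indicator_of_notMem (s := {ω' | X ω' = e}) (fun h => he (Eq.symm h)) _
  have hint : ∀ e ∈ E, Integrable (Set.indicator {ω | X ω = e} (fun _ => g e)) μ :=
    fun e _ => (integrable_const _).indicator (hmeas e)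
  refine ⟨(integrable_finsetSum _ hint).congr heq, ?_⟩
  rw [← integral_congr_ae heq, integral_finsetSum _ hint]
  refine sum_congr rfl fun e he => ?_
  rw [integral_indicator_const _ (hmeas e), hX.2 e he, smul_eq_mul]

theorem isDistribution_pi_single {e : S} [DecidableEq S] (he : e ∈ E) :
    IsDistribution E (fun x => if x = e then 1 else 0) := by
  refine ⟨fun x _ => by positivity, ?_⟩
  simp [he]

theorem IsDistribution.abs_sum_mul_le {p v : S → ℝ} (hp : IsDistribution E p)
    (hv : ∀ e ∈ E, |v e| ≤ 1) : |∑ e ∈ E, p e * v e| ≤ 1 := by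
  rw [← hp.2]
  refine (abs_sum_le_sum_abs _ _).trans (sum_le_sum fun e he => ?_)
  rw [abs_mul, abs_of_nonneg (hp.1 e he)]
  exact mul_le_of_le_one_right (hp.1 e he) (hv e he)

/-- Smoothing with parameter `α` costs at most `2 α` per round. -/
theorem sum_mul_le_sum_smoothed_mul {p v : S → ℝ} (hp : IsDistribution E p)
    (hv : ∀ e ∈ E, |v e| ≤ 1) {α : ℝ} (hα : 0 ≤ α) :
    ∑ e ∈ E, p e * v e ≤ ∑ e ∈ E, smoothed E α p e * v e + 2 * α := by
  have hN : (#E : ℝ) ≠ 0 := by exact_mod_cast hp.nonempty.card_pos.ne'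
  have hu : IsDistribution E (fun _ => 1 / (#E : ℝ)) := ⟨fun _ _ => by positivity, by simp [hN]⟩
  have h1 : ∑ e ∈ E, smoothed E α p e * v e =
      ∑ e ∈ E, p e * v e - α * (∑ e ∈ E, p e * v e) + α * ∑ e ∈ E, 1 / (#E : ℝ) * v e := by
    rw [mul_sum, mul_sum, ← sum_sub_distrib, ← sum_add_distrib]
    refine sum_congr rfl fun e _ => ?_
    rw [smoothed]
    ring
  have h2 := mul_le_mul_of_nonneg_left (abs_le.1 (hp.abs_sum_mul_le hv)).2 hα
  have h3 := mul_le_mul_of_nonneg_left (abs_le.1 (hu.abs_sum_mul_le hv)).1 hα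
  linarith

variable {d k : ℕ} [NeZero d]

/-- Each commitment is nearly matched by a point of `E`, whose point mass competes with the optimum
in hindsight. -/
theorem sSup_sum_defenderUtility_le {θ : Fin k → AttackerType d} {γ : ℝ}
    {E : Finset (Fin d → ℝ)} (hE : IsExtremePointSet θ γ (E : Set (Fin d → ℝ)))
    {u : Fin d → Fin d → ℝ} (hu : ∀ a i, |u a i| ≤ 1) {f : ℕ → Fin k} {m : ℕ}
    {p : (Fin d → ℝ) → ℝ}
    (hp : IsOptimalInHindsight E m (fun i x => defenderUtility (θ (f i)) u x) p) :
    sSup ((fun z => ∑ i ∈ range m, defenderUtility (θ (f i)) u z) '' stdSimplex ℝ (Fin d)) ≤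
      ∑ i ∈ range m, ∑ e ∈ E, p e * defenderUtility (θ (f i)) u e + γ * m := by
  refine csSup_le (Set.Nonempty.image _ ⟨_, single_mem_stdSimplex ℝ (0 : Fin d)⟩) ?_
  rintro _ ⟨z, hz, rfl⟩
  obtain ⟨e, he, hle⟩ := hE.exists_sum_defenderUtility_ge hu f m hz
  have he : e ∈ E := he
  refine hle.trans (add_le_add_left ?_ _)
  classical
  have := hp.2 _ (isDistribution_pi_single he)
  simpa [he] using this

/-- The setting of a single task: regret is integrable, and its expectation is at most the regret
against the smoothed optimum plus the costs of discretization and smoothing. -/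
theorem integral_stackelbergRegret_le {θ : Fin k → AttackerType d} {α : ℝ} (hα : 0 ≤ α)
    {E : Finset (Fin d → ℝ)} (hE : IsExtremePointSet θ α (E : Set (Fin d → ℝ)))
    {u : Fin d → Fin d → ℝ} (hu : ∀ a i, |u a i| ≤ 1) {f : ℕ → Fin k} {m : ℕ}
    {p : (Fin d → ℝ) → ℝ}
    (hp : IsOptimalInHindsight E m (fun i x => defenderUtility (θ (f i)) u x) p)
    {Ω : Type*} [MeasurableSpace Ω] {μ : Measure Ω} [IsProbabilityMeasure μ]
    {X : ℕ → Ω → (Fin d → ℝ)} {Y : ℕ → (Fin d → ℝ) → ℝ}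
    (hY : ∀ i < m, IsDistribution E (Y i)) (hX : ∀ i < m, IsDrawnFrom μ (X i) E (Y i)) :
    Integrable (fun ω => stackelbergRegret θ u f m (fun i => X i ω)) μ ∧
      ∫ ω, stackelbergRegret θ u f m (fun i => X i ω) ∂μ ≤ 3 * (α * m) +
        ∑ i ∈ range m, (∑ e ∈ E, smoothed E α p e * defenderUtility (θ (f i)) u e -
          ∑ e ∈ E, Y i e * defenderUtility (θ (f i)) u e) := by
  have hi : ∀ i ∈ range m, Integrable (fun ω => defenderUtility (θ (f i)) u (X i ω)) μ ∧
      ∫ ω, defenderUtility (θ (f i)) u (X i ω) ∂μ =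
        ∑ e ∈ E, Y i e * defenderUtility (θ (f i)) u e := fun i hi =>
    integral_comp_of_isDrawnFrom (hX i (mem_range.1 hi)) (hY i (mem_range.1 hi)).2 _
  have hsum := integrable_finsetSum (range m) fun i h => (hi i h).1
  unfold stackelbergRegret
  refine ⟨(integrable_const _).sub hsum, ?_⟩
  rw [integral_sub (integrable_const _) hsum, integral_const, probReal_univ, one_smul,
    integral_finsetSum _ fun i h => (hi i h).1, sum_congr rfl fun i h => (hi i h).2]
  have h1 := sSup_sum_defenderUtility_le hE hu hp
  have h2 : ∑ i ∈ range m, ∑ e ∈ E, p e * defenderUtility (θ (f i)) u e ≤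
      ∑ i ∈ range m, (∑ e ∈ E, smoothed E α p e * defenderUtility (θ (f i)) u e + 2 * α) :=
    sum_le_sum fun i _ => sum_mul_le_sum_smoothed_mul hp.1
      (fun e he => abs_defenderUtility_le_one hu (hE.subset_stdSimplex he)) hα
  rw [sum_add_distrib, sum_const, card_range, nsmul_eq_mul] at h2
  rw [sum_sub_distrib]
  linarith

theorem offset_mul (m T : ℕ) : offset m T * m = √((m : ℝ) / T) := by
  rw [offset, sqrt_mul (Nat.cast_nonneg m), sqrt_div (Nat.cast_nonneg m)]
  rcases Nat.eq_zero_or_pos m with rfl | hm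
  · simp
  have hm : 0 < √(m : ℝ) := sqrt_pos.2 (by exact_mod_cast hm)
  rw [div_mul_eq_mul_div, one_mul]
  nth_rewrite 1 [← mul_self_sqrt (Nat.cast_nonneg (α := ℝ) m)]
  rw [mul_div_mul_left _ _ hm.ne']

theorem isDistribution_metaMWU {m T : ℕ} {y : ℕ → S → ℝ} (v : ℕ → ℕ → S → ℝ) (hE : E.Nonempty)
    (hm : 1 ≤ m) (hT : 1 ≤ T) (hy : ∀ t < T, IsDistribution E (y t)) {t : ℕ} (ht : t < T) (i : ℕ) :
    IsDistribution E (metaMWU E m T v y t i) := by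
  have hN : (0 : ℝ) < #E := by exact_mod_cast hE.card_pos
  exact isDistribution_mwu hE
    (fun e he => (div_pos (offset_pos hm hT) hN).trans_le (le_metaInit hm hT hy ht.le he))
    (isDistribution_metaInit hE hm hT hy ht.le).2 _ _ _

/-- The average over the tasks of the regret of meta-learned multiplicative weights against the
smoothed optima. -/
theorem sum_regret_metaMWU_le {m T : ℕ} {y : ℕ → S → ℝ} {v : ℕ → ℕ → S → ℝ} (hE : E.Nonempty)
    (hm : 1 ≤ m) (hT : 1 ≤ T) (hy : ∀ t < T, IsDistribution E (y t))
    (hv : ∀ t < T, ∀ i < m, ∀ e ∈ E, |v t i e| ≤ 1) {η : ℝ} (hη : 0 < η) :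
    (∑ t ∈ range T, ∑ i ∈ range m, (∑ e ∈ E, smoothed E (offset m T) (y t) e * v t i e -
        ∑ e ∈ E, metaMWU E m T v y t i e * v t i e)) / T ≤
      √(m * log (#E * √(m * T))) *
          (min (√(log (#E * √(m * T))) / (η * √(T * m))) (1 / (T : ℝ) ^ (1 / 4 : ℝ))
            + (1 + log ((T : ℝ) + 1)) / (2 * √T))
        + (η * m + shannonEntropy E (averageDist y T) / η
            + 8 * #E * √m * (log T + 1) / (η * √T)) := by
  have hm0 : (0 : ℝ) < m := by exact_mod_cast hm
  have hT1 : (1 : ℝ) ≤ T := by exact_mod_cast hT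
  have hT0 : (0 : ℝ) < T := by linarith
  have hN1 : (1 : ℝ) ≤ #E := by exact_mod_cast hE.card_pos
  have hα := offset_pos hm hT
  have hα1 := offset_le_one hm hT
  have hs1 : 1 ≤ √((m : ℝ) * T) := by
    rw [one_le_sqrt]
    exact_mod_cast Nat.mul_le_mul hm hT
  have hH := shannonEntropy_nonneg (isDistribution_averageDist (by omega : T ≠ 0) hy)
  have hL : 0 ≤ log (T : ℝ) := log_nonneg hT1
  have hL' : 0 ≤ log ((T : ℝ) + 1) := log_nonneg (by linarith)
  have hys := fun t ht => isDistribution_smoothed (hy t ht) hα.le hα1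
  have hδ : 0 < offset m T / #E := by positivity
  have hinit := fun t ht => isDistribution_metaInit hE hm hT hy (t := t) ht
  have hinit_pos : ∀ t < T, ∀ e ∈ E, 0 < metaInit E m T y t e := fun t ht e he =>
    hδ.trans_le (le_metaInit hm hT hy (le_of_lt ht) he)
  -- When `|E| = 1`, `D` may vanish and the rate is then meaningless; but there is only one
  -- distribution, so the regret is zero. Otherwise `D > 0`.
  rcases (Nat.one_le_iff_ne_zero.2 hE.card_pos.ne').eq_or_lt with hcard | hcard
  · obtain ⟨a, rfl⟩ := card_eq_one.1 hcard.symm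
    have hzero : ∀ t ∈ range T, ∑ i ∈ range m,
        (∑ e ∈ {a}, smoothed {a} (offset m T) (y t) e * v t i e -
          ∑ e ∈ {a}, metaMWU {a} m T v y t i e * v t i e) = 0 := by
      intro t ht
      refine sum_eq_zero fun i _ => ?_
      have h1 := (hys t (mem_range.1 ht)).2
      have h2 := (isDistribution_metaMWU v hE hm hT hy (mem_range.1 ht) i).2
      rw [sum_singleton] at h1 h2
      simp [h1, h2]
    rw [sum_eq_zero hzero, zero_div]
    positivity
  have hcard : (1 : ℝ) < #E := by exact_mod_cast hcard
  set P := log (#E * √((m : ℝ) * T)) with hP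
  have hP0 : 0 < P := log_pos (by nlinarith)
  have hD : ewooD E m T = √P / √m := by
    rw [ewooD, card_div_offset, ← hP, sqrt_div hP0.le]
  have hD0 : 0 < ewooD E m T := by
    rw [hD]
    positivity
  have hmD2 : m * ewooD E m T ^ 2 = P := by
    rw [hD, div_pow, sq_sqrt hP0.le, sq_sqrt hm0.le, mul_div_cancel₀ _ hm0.ne']
  have hρ0 : 0 < ewooRho T := rpow_pos_of_pos hT0 _
  have hρ1 : ewooRho T ≤ 1 := rpow_le_one_of_one_le_of_nonpos hT1 (by norm_num)
  have hρ : ewooRho T = 1 / (T : ℝ) ^ (1 / 4 : ℝ) := by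
    rw [ewooRho, rpow_neg hT0.le, one_div ((T : ℝ) ^ _)]
  have hρ2 : ewooRho T ^ 2 = 1 / √T := by
    rw [ewooRho, sqrt_eq_rpow, ← rpow_natCast, ← rpow_mul hT0.le, one_div ((T : ℝ) ^ _),
      ← rpow_neg hT0.le]
    norm_num
  have hβ : ewooBeta E m T = 2 / (m * ewooD E m T) * ewooRho T ^ 2 := by
    rw [ewooBeta, min_eq_right (pow_le_one₀ hρ0.le hρ1)]
  obtain ⟨hrate, hsum⟩ := sum_rate_regret_le hm0 hD0 hρ0 hρ1 hβ hT
    (K := fun t => klDivergence E (smoothed E (offset m T) (y t)) (metaInit E m T y t))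
    (fun t ht => ⟨klDivergence_nonneg (hys t ht) (hinit_pos t ht) (hinit t ht.le).2, by
      rw [hmD2, hP, ← card_div_offset, ← one_div_div]
      exact klDivergence_le_log (hys t ht) hδ fun e he => le_metaInit hm hT hy ht.le he⟩)
    (U := regretSurrogate E m T y) (fun _ _ => rfl) (η := ewooRate E m T y) (fun _ _ => rfl) hη
  have htask : ∑ t ∈ range T, ∑ i ∈ range m,
      (∑ e ∈ E, smoothed E (offset m T) (y t) e * v t i e -
        ∑ e ∈ E, metaMWU E m T v y t i e * v t i e) ≤
      ∑ t ∈ range T, (klDivergence E (smoothed E (offset m T) (y t)) (metaInit E m T y t) /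
        ewooRate E m T y t + m * ewooRate E m T y t / 2) := by
    refine sum_le_sum fun t ht => ?_
    have ht := mem_range.1 ht
    have h0 := hrate t ht
    have h := mul_regret_mwu_le hE (hinit_pos t ht) (hinit t ht.le).2 (hv t ht) (hys t ht)
      (ewooRate E m T y t)
    rw [← le_div_iff₀' h0] at h
    refine h.trans_eq ?_
    field_simp
  have hK := sum_klDivergence_metaInit_le hE hm hT hy
  have hsT : 0 < √(T : ℝ) := sqrt_pos.2 hT0
  have hsm : 0 < √(m : ℝ) := sqrt_pos.2 hm0
  have hTT : √(T : ℝ) * √T = T := mul_self_sqrt hT0.le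
  have hmm : √(m : ℝ) * √m = m := mul_self_sqrt hm0.le
  have hKT : (∑ t ∈ range T, klDivergence E (smoothed E (offset m T) (y t)) (metaInit E m T y t)) /
      η ≤ T * (shannonEntropy E (averageDist y T) / η +
        8 * #E * √m * (log T + 1) / (η * √T)) := by
    rw [div_le_iff₀ hη]
    refine hK.trans_eq ?_
    have h1 : T * (shannonEntropy E (averageDist y T) / η +
        8 * #E * √m * (log T + 1) / (η * √T)) * η =
        T * shannonEntropy E (averageDist y T) + 8 * #E * √m * (log T + 1) * (T / √T) := by
      field_simp
    rw [h1, div_sqrt, sqrt_mul hm0.le]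
    ring
  have hmD : m * ewooD E m T = √(m * P) := by
    rw [hD, sqrt_mul hm0.le]
    nth_rewrite 1 [← hmm]
    field_simp
  have hmin : ewooD E m T * ewooRho T ^ 2 / η = √P / (η * √(T * m)) := by
    rw [hD, hρ2, sqrt_mul hT0.le]
    field_simp
  have hlast : (1 + log ((T : ℝ) + 1)) * (m * ewooD E m T / (2 * ewooRho T ^ 2)) =
      T * (√(m * P) * ((1 + log ((T : ℝ) + 1)) / (2 * √T))) := by
    rw [hmD, hρ2]
    nth_rewrite 3 [← hTT]
    field_simp
  rw [hlast, hmin, hmD, hρ] at hsum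
  rw [div_le_iff₀ hT0]
  linarith

end Regret

/-! ### Assembly -/

theorem mainTheorem7 {d k : ℕ} [NeZero d] (θ : Fin k → AttackerType d)
    (m T : ℕ) (hm : 1 ≤ m) (hT : 1 ≤ T) :
    -- extreme-point sets of precision `1 / √(m T)` exist, and all of them are finite and nonempty
    (∃ E : Set (Fin d → ℝ), IsExtremePointSet θ (offset m T) E) ∧
    (∀ E : Set (Fin d → ℝ), IsExtremePointSet θ (offset m T) E → E.Finite ∧ E.Nonempty) ∧
    ∀ (E : Finset (Fin d → ℝ)), IsExtremePointSet θ (offset m T) (E : Set (Fin d → ℝ)) →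
    -- `u t`: payoff vectors of the defender in task `t`; `f t i`: attacker type in round `i` of task `t`
    ∀ (u : ℕ → Fin d → Fin d → ℝ), (∀ t < T, ∀ a i, |u t a i| ≤ 1) →
    ∀ (f : ℕ → ℕ → Fin k),
    -- `y t`: the optimum-in-hindsight distribution of task `t`
    ∀ (y : ℕ → (Fin d → ℝ) → ℝ),
    (∀ t < T, IsOptimalInHindsight E m (fun i x => defenderUtility (θ (f t i)) (u t) x) (y t)) →
    -- `X t i`: the random commitment in round `i` of task `t`
    ∀ {Ω : Type*} [MeasurableSpace Ω] (μ : Measure Ω) [IsProbabilityMeasure μ]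
      (X : ℕ → ℕ → Ω → (Fin d → ℝ)),
    (∀ t < T, ∀ i < m, IsDrawnFrom μ (X t i) E
      (metaMWU E m T (fun s j x => defenderUtility (θ (f s j)) (u s) x) y t i)) →
    (∀ t < T, Integrable
      (fun ω => stackelbergRegret θ (u t) (f t) m (fun i => X t i ω)) μ) ∧
    (∀ η : ℝ, 0 < η →
      (∑ t ∈ range T, ∫ ω, stackelbergRegret θ (u t) (f t) m (fun i => X t i ω) ∂μ) / T ≤
        4 * √((m : ℝ) / T)
        + √(m * log (#E * √(m * T))) *
            (min (√(log (#E * √(m * T))) / (η * √(T * m))) (1 / (T : ℝ) ^ (1 / 4 : ℝ))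
              + (1 + log ((T : ℝ) + 1)) / (2 * √T))
        + (η * m + shannonEntropy E (averageDist y T) / η
            + 8 * #E * √m * (log T + 1) / (η * √T))) ∧
    (∑ t ∈ range T, ∫ ω, stackelbergRegret θ (u t) (f t) m (fun i => X t i ω) ∂μ) / T ≤
      2 * √(shannonEntropy E (averageDist y T) * m)
        + 16 * m * #E * (1 + log T) / (T : ℝ) ^ (1 / 4 : ℝ) := by
  refine ⟨exists_isExtremePointSet θ (offset_pos hm hT), fun E hE => ⟨hE.finite, hE.nonempty⟩, ?_⟩
  intro E hE u hu f y hy Ω _ μ _ X hX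
  have hne : E.Nonempty := hE.nonempty
  have hT0 : (0 : ℝ) < T := by exact_mod_cast hT
  have hyd : ∀ t < T, IsDistribution E (y t) := fun t ht => (hy t ht).1
  have hY := fun t ht i => isDistribution_metaMWU
    (fun s j x => defenderUtility (θ (f s j)) (u s) x) hne hm hT hyd (t := t) ht i
  have htask := fun t ht => integral_stackelbergRegret_le (offset_pos hm hT).le hE (hu t ht)
    (hy t ht) (fun i _ => hY t ht i) (hX t ht)
  have hbound := fun (η : ℝ) (hη : 0 < η) => sum_regret_metaMWU_le
    (v := fun s j x => defenderUtility (θ (f s j)) (u s) x) hne hm hT hyd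
    (fun t ht i _ e he => abs_defenderUtility_le_one (hu t ht) (hE.subset_stdSimplex he)) hη
  have hsum := sum_le_sum fun t ht => (htask t (mem_range.1 ht)).2
  rw [sum_add_distrib, sum_const, card_range, nsmul_eq_mul, offset_mul] at hsum
  have hmain : ∀ η : ℝ, 0 < η →
      (∑ t ∈ range T, ∫ ω, stackelbergRegret θ (u t) (f t) m (fun i => X t i ω) ∂μ) / T ≤
        4 * √((m : ℝ) / T)
        + √(m * log (#E * √(m * T))) *
            (min (√(log (#E * √(m * T))) / (η * √(T * m))) (1 / (T : ℝ) ^ (1 / 4 : ℝ))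
              + (1 + log ((T : ℝ) + 1)) / (2 * √T))
        + (η * m + shannonEntropy E (averageDist y T) / η
            + 8 * #E * √m * (log T + 1) / (η * √T)) := by
    intro η hη
    have h1 := div_le_div_of_nonneg_right hsum hT0.le
    rw [add_div, mul_div_cancel_left₀ _ hT0.ne'] at h1
    have h2 := hbound η hη
    -- Discretization and smoothing together cost only `3 √(m / T)`; the stated constant 4 has
    -- slack.
    have h3 : 0 ≤ √((m : ℝ) / T) := sqrt_nonneg _
    linarith
  exact ⟨fun t ht => (htask t ht).1, hmain, explicit_regret_bound hm hT hne.card_pos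
    (shannonEntropy_nonneg (isDistribution_averageDist (by omega) hyd)) hmain⟩
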